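/- Consider the $2\times 2$ MIMO X network with $M_t$ antennas at transmitter $t$ and $N_r$ antennas at receiver $r$ ($t,r\in\{1,2\}$): there is an independent message for each pair (receiver $r$, transmitter $t$), and the received signals are $\mathbf Y_r=\mathbf H_{r1}\mathbf x_1+\mathbf H_{r2}\mathbf x_2+\mathbf z_r$ with i.i.d. $\mathcal{CN}(0,1)$ noise, average power at most $\rho$ at each transmitter, and constant channel matrices $\mathbf H_{rt}\in\mathbb C^{N_r\times M_t}$, known at all nodes, whose entries are drawn i.i.d. from $\mathcal{CN}(0,v)$, $v>0$. The degrees of freedom (DoF) of a message are $\lim_{\rho\to\infty}R(\rho)/\log_2\rho$, where $R(\rho)$ are achievable rates. An asymmetric interference alignment and cancelation scheme consists of message vectors $\mathbf m_{rt}$ of real symbols, each divided into three blocks of lengths $b_{rt}^1,b_{rt}^2,b_{rt}^3\ge 0$, $Q_{rt}=b_{rt}^1+b_{rt}^2+b_{rt}^3$, and of precoding vectors in $\mathbb C^{M_t}$, namely $\mathbf v_{rt}^k$, $\mathbf w_{rt}^k$, $\mathbf u_{rt}^k$ for the three blocks, such that, with $r'$ the receiver other than $r$: (i) the vectors $\mathbf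 v_{rt}^k$ are linearly independent over $\mathbb C$ and $\mathbf H_{r't}\mathbf v_{rt}^k=0$; (ii) $b_{rt}^2\le b_{rt}^1$ and $\mathbf w_{rt}^k=\mathbf j\,\mathbf v_{rt}^k$; (iii) the vectors $\mathbf H_{r't}\mathbf u_{rt}^k$ are linearly independent over $\mathbb C$ for each $r,t$; moreover $b_{r1}^3\le b_{r2}^3$, and $\mathbf H_{r'2}\mathbf u_{r2}^k$ and $\mathbf H_{r'1}\mathbf u_{r1}^k$ span the same real line for $k\le b_{r1}^3$; (iv) at each receiver $r$ the received directions $\mathbf H_{rt}\mathbf v_{rt}^k,\mathbf H_{rt}\mathbf w_{rt}^k,\mathbf H_{rt}\mathbf u_{rt}^k$ ($t=1,2$) of all desired symbols, together with the interference directions $\mathbf H_{r2}\mathbf u_{r'2}^k$, are linearly independent over $\mathbb R$. **Theorem.** Let $M_1\ge M_2\ge N_1\ge N_2\ge 1$, $M_1+M_2\le 3N_2$, and $x=3N_2-(M_1+M_2)$. Put $$D=M_1+M_2-N_2+\tfrac12\left\lfloor\tfrac{2x}{3}\right\rfloor .$$ Then $D$ equals $\frac{2(M_1+M_2)}3$ if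 $x\equiv 0$, $\frac{2(M_1+M_2)}3-\frac13$ if $x\equiv1$, and $\frac{2(M_1+M_2)}3-\frac16$ if $x\equiv2\pmod 3$ (where $\frac{2(M_1+M_2)}3$ is the known outer bound for the DoF in this case). For almost every channel realization there is a scheme with message vector lengths $$Q_{11}=Q_{21}=2(M_1-N_2)+\left\lfloor\tfrac{2x}3\right\rfloor,\quad Q_{12}=M_2+N_2-M_1-\left\lceil\tfrac{x-1}3\right\rceil,\quad Q_{22}=M_2+N_2-M_1-\left\lfloor\tfrac x3\right\rfloor,$$ and codes that send real message symbols along its precoding vectors, without symbol extension, achieve $Q_{rt}/2$ DoF for the message from transmitter $t$ to receiver $r$ simultaneously for all $r,t$, hence the total $\frac12\sum_{r,t}Q_{rt}=D$. All $Q_{rt}$ are positive if $N_1\ge2$ and not $M_1+M_2=3N_2=2N_1+N_2$. No scheme of this form has a larger value of $\frac12\sum_{r,t}Q_{rt}$. -/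

import Mathlib

open MeasureTheory ProbabilityTheory Filter Topology
open scoped NNReal ENNReal Matrix

namespace MIMOX

noncomputable section

/-! ### Channel

Transmitters 1, 2 and receivers 1, 2 are the indices `0, 1 : Fin 2`; transmitter `t` has
`M t` antennas and receiver `r` has `N r` antennas. The receiver other than `r` is `1 - r`. -/

/-- The circularly symmetric complex Gaussian law `CN(0, v)`: real and imaginary parts are
independent centred Gaussians of variance `v / 2`. -/
def complexGaussian (v : ℝ≥0) : Measure ℂ :=
  ((gaussianReal 0 (v / 2)).prod (gaussianReal 0 (v / 2))).map
    Complex.measurableEquivRealProd.symm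

/-- Constant channel coefficients: `H r t i j` is the gain from antenna `j` of transmitter `t` to
antenna `i` of receiver `r`. The channel matrix from `t` to `r` is `Matrix.of (H r t)`. -/
abbrev Channel (M N : Fin 2 → ℕ) : Type :=
  (r t : Fin 2) → Fin (N r) → Fin (M t) → ℂ

/-- The law of the channel: all coefficients are i.i.d. `CN(0, v)`. -/
def channelLaw (M N : Fin 2 → ℕ) (v : ℝ≥0) : Measure (Channel M N) :=
  Measure.pi fun r => Measure.pi fun t =>
    Measure.pi fun _ : Fin (N r) => Measure.pi fun _ : Fin (M t) => complexGaussian v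

/-- The noise at a receiver with `a` antennas during `n` channel uses: i.i.d. `CN(0, 1)`. -/
def noiseLaw (n a : ℕ) : Measure (Fin n → Fin a → ℂ) :=
  Measure.pi fun _ => Measure.pi fun _ => complexGaussian 1

/-! ### Signal design -/

/-- `b r t i` is the length of block number `i + 1` of the message vector `m_{rt}` from
transmitter `t` to receiver `r`. In the usual letters `b 0 0 = (L₁, L₂, L₃)`,
`b 1 0 = (K₁, K₂, K₃)`, `b 0 1 = (J₁, J₂, J₃)` and `b 1 1 = (G₁, G₂, G₃)`. -/
abbrev BlockLengths : Type := Fin 2 → Fin 2 → Fin 3 → ℕ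

/-- The length `Q_{rt}` of the message vector `m_{rt}`. -/
def msgLength (b : BlockLengths) (r t : Fin 2) : ℕ := ∑ i, b r t i

/-- Positions in the message vector `m_{rt}`. -/
abbrev Stream (b : BlockLengths) (r t : Fin 2) : Type := (i : Fin 3) × Fin (b r t i)

/-- Precoding vectors: `P r t 0`, `P r t 1`, `P r t 2` are the families `v_{rt}`, `w_{rt}`,
`u_{rt}` for the first, second and third block of `m_{rt}`. -/
abbrev Precoders (M : Fin 2 → ℕ) (b : BlockLengths) : Type :=
  (r t : Fin 2) → (i : Fin 3) → Fin (b r t i) → Fin (M t) → ℂ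

/-- The asymmetric interference alignment and cancelation scheme for the channel `H`. Received
vectors in `ℂ ^ (N r)` are compared in the underlying real vector space, because all messages
are real. -/
structure IsScheme {M N : Fin 2 → ℕ} (H : Channel M N) (b : BlockLengths)
    (P : Precoders M b) : Prop where
  /-- The vectors `v_{rt}` are independent. -/
  indep_v : ∀ r t, LinearIndependent ℂ (P r t 0)
  /-- The vectors `v_{rt}` are nulled at the unintended receiver. -/
  null_v : ∀ r t k, Matrix.of (H (1 - r) t) *ᵥ P r t 0 k = 0
  /-- There are no more vectors `w_{rt}` than `v_{rt}`. -/
  le_v : ∀ r t, b r t 1 ≤ b r t 0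
  /-- `w_{rt}^k = j v_{rt}^k`. -/
  rot_w : ∀ r t k, P r t 1 k = Complex.I • P r t 0 (Fin.castLE (le_v r t) k)
  /-- The vectors `u_{rt}` are independent modulo the null space of the cross channel. -/
  indep_u : ∀ r t, LinearIndependent ℂ fun k => Matrix.of (H (1 - r) t) *ᵥ P r t 2 k
  /-- The third block of transmitter 2 is at least as long as that of transmitter 1. -/
  le_u : ∀ r, b r 0 2 ≤ b r 1 2
  /-- At the unintended receiver each signal of the third block of transmitter 1 is aligned, in
  real space, with one signal of the third block of transmitter 2. -/
  aligned : ∀ r k,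
    Submodule.span ℝ {Matrix.of (H (1 - r) 1) *ᵥ P r 1 2 (Fin.castLE (le_u r) k)} =
    Submodule.span ℝ {Matrix.of (H (1 - r) 0) *ᵥ P r 0 2 k}
  /-- At each receiver all desired signals and the remaining interference directions (the third
  block of transmitter 2 meant for the other receiver) are jointly independent in real space. -/
  indep_rx : ∀ r, LinearIndependent ℝ
    (Sum.elim
      (fun q : (t : Fin 2) × Stream b r t =>
        Matrix.of (H r q.1) *ᵥ P r q.1 q.2.1 q.2.2)
      (fun k : Fin (b (1 - r) 1 2) => Matrix.of (H r 1) *ᵥ P (1 - r) 1 2 k) :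
      ((t : Fin 2) × Stream b r t) ⊕ Fin (b (1 - r) 1 2) → (Fin (N r) → ℂ))

/-! ### Codes, rates and degrees of freedom -/

/-- A block code of length `n` for the X channel: an independent message with `W r t` values from
each transmitter `t` to each receiver `r`. -/
structure XCode (M N : Fin 2 → ℕ) (n : ℕ) where
  W : Fin 2 → Fin 2 → ℕ
  enc : (t : Fin 2) → ((r : Fin 2) → Fin (W r t)) → Fin n → Fin (M t) → ℂ
  dec : (r : Fin 2) → (Fin n → Fin (N r) → ℂ) → (t : Fin 2) → Fin (W r t)
  measurable_dec : ∀ r, Measurable (dec r)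

variable {M N : Fin 2 → ℕ} {n : ℕ}

/-- The average transmit power over the block is at most `ρ` at each transmitter, whatever the
messages are. -/
def XCode.PowerLE (c : XCode M N n) (ρ : ℝ) : Prop :=
  ∀ t m, ∑ s, ∑ a, ‖c.enc t m s a‖ ^ 2 ≤ n * ρ

/-- What receiver `r` observes if the messages are `m` and the noise is `z`. -/
def XCode.received (c : XCode M N n) (H : Channel M N) (m : (r t : Fin 2) → Fin (c.W r t))
    (r : Fin 2) (z : Fin n → Fin (N r) → ℂ) : Fin n → Fin (N r) → ℂ :=
  fun s => (∑ t, Matrix.of (H r t) *ᵥ c.enc t (fun r' => m r' t) s) + z s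

/-- For all messages, each receiver errs with probability at most `ε`. -/
def XCode.ErrorLE (c : XCode M N n) (H : Channel M N) (ε : ℝ) : Prop :=
  ∀ m r, noiseLaw n (N r) {z | c.dec r (c.received H m r z) ≠ m r} ≤ ENNReal.ofReal ε

/-- The encoders send real message symbols along the precoding vectors `P`, without symbol
extension: in every channel use `s`, transmitter `t` sends the sum over `r` of the precoding
vectors `P r t`, weighted with a real vector that encodes the message for receiver `r` only. -/
def XCode.IsPrecoded (c : XCode M N n) {b : BlockLengths} (P : Precoders M b) : Prop :=
  ∃ f : (r t : Fin 2) → Fin (c.W r t) → Fin n → Stream b r t → ℝ,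
    ∀ t m s, c.enc t m s = ∑ r, ∑ q : Stream b r t, f r t (m r) s q • P r t q.1 q.2

/-- The rates `R r t` (bits per channel use) are achievable at power `ρ` with the precoders `P`:
for large `n` there are codes of length `n` with at least `2 ^ (n R r t)` messages and
arbitrarily small error probability. -/
def RateAchievable (H : Channel M N) {b : BlockLengths} (P : Precoders M b) (ρ : ℝ)
    (R : Fin 2 → Fin 2 → ℝ) : Prop :=
  ∀ ε : ℝ, 0 < ε → ∃ n₀ : ℕ, ∀ n ≥ n₀, ∃ c : XCode M N n,
    c.IsPrecoded P ∧ c.PowerLE ρ ∧ c.ErrorLE H ε ∧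
      ∀ r t, (2 : ℝ) ^ ((n : ℝ) * R r t) ≤ c.W r t

/-- With the precoders `P` the degrees of freedom `d r t = lim R_{rt}(ρ) / log₂ ρ` are
achieved. -/
def AchievesDoF (H : Channel M N) {b : BlockLengths} (P : Precoders M b)
    (d : Fin 2 → Fin 2 → ℝ) : Prop :=
  ∃ R : ℝ → Fin 2 → Fin 2 → ℝ,
    (∀ ρ > 0, (∀ r t, 0 ≤ R ρ r t) ∧ RateAchievable H P ρ (R ρ)) ∧
      ∀ r t, Tendsto (fun ρ => R ρ r t / Real.logb 2 ρ) atTop (𝓝 (d r t))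

end

end MIMOX

namespace MIMOX

noncomputable section

/-! Upper bound. Nulled symbols cost nothing at the other receiver, but the null space of a cross
link has complex dimension only `M t - N (1 - r)`. Of the third blocks, transmitter 1 carries at
least half of the symbols, and each of these occupies a real dimension at the other receiver.
Counting the `2 * N r` real dimensions at both receivers gives three times the total length at most
`4 * (M 0 + M 1)`. The total is an integer, and the floor of `4 * (M 0 + M 1) / 3` is exactly `2 *
D`.

Existence. Let the first two blocks use the whole null space of the cross link, and let the `k`-th
vector of each third block be a preimage of the `k`-th unit vector under the cross link. Alignment
is then automatic, and the interference at a receiver lies along the first real unit vectors. What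
remains is that a real-linear system, with coefficients affine in the channel, has only the trivial
solution (`Separates`). By `ae_injective_of_affine` this holds almost everywhere once it holds for
one channel, and `separates_stackedChannel` supplies that channel. The lengths `alignedLengths` fill
all real dimensions of both receivers and attain the upper bound.

Degrees of freedom. Zero forcing (`IsScheme.exists_zeroForcing`) yields every desired real symbol
plus noise whose law does not depend on the power. Integer words from an `ℓ¹` packing, sent with
fixed spacing and an alphabet of order `√ρ`, lose only boundedly many bits per channel use
(`IsScheme.exists_codes`), so each symbol carries half of `log₂ ρ` asymptotically. -/

/-! ### Generic injectivity of affine families of linear maps -/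

/-- A perturbation `f + t • g` of an injective linear map is injective for all but finitely
many `t`. -/
lemma finite_setOf_not_injective_add_smul {E F : Type*} [AddCommGroup E] [Module ℝ E]
    [FiniteDimensional ℝ E] [AddCommGroup F] [Module ℝ F] (f g : E →ₗ[ℝ] F)
    (hf : Function.Injective f) :
    {t : ℝ | ¬ Function.Injective (f + t • g)}.Finite := by
  -- If `l ∘ f = id`, a kernel vector `x` of `f + t • g` satisfies `l (g x) = -t⁻¹ • x`, so `t` is
  -- determined by one of the finitely many eigenvalues of `l ∘ g`.
  obtain ⟨l, hl⟩ := LinearMap.exists_leftInverse_of_injective f (LinearMap.ker_eq_bot.2 hf)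
  have hfin := (Module.End.finite_hasEigenvalue (R := ℝ) (M := E) (l ∘ₗ g)).image (fun s => -s⁻¹)
  refine hfin.subset fun t ht => ?_
  have hker : LinearMap.ker (f + t • g) ≠ ⊥ := fun h => ht (LinearMap.ker_eq_bot.1 h)
  obtain ⟨x, hx, hx0⟩ := (Submodule.ne_bot_iff _).1 hker
  have hlx : x + t • l (g x) = 0 := by
    have h1 := congrArg l (LinearMap.mem_ker.1 hx)
    have h2 := LinearMap.congr_fun hl x
    simpa [h2] using! (by simpa [show l (f x) = x from h2] using h1 : x + t • l (g x) = 0)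
  have ht0 : t ≠ 0 := by
    rintro rfl
    exact hx0 (by simpa using hlx)
  refine ⟨-t⁻¹, ?_, by simp⟩
  refine Module.End.hasEigenvalue_of_hasEigenvector (x := x)
    ⟨Module.End.mem_eigenspace_iff.2 ?_, hx0⟩
  have h3 : t⁻¹ • (x + t • l (g x)) = 0 := by rw [hlx, smul_zero]
  rw [smul_add, inv_smul_smul₀ ht0] at h3
  rw [LinearMap.comp_apply, neg_smul]
  exact eq_neg_of_add_eq_zero_right h3

/-- An affine family of linear maps with an injective member is injective almost everywhere. -/
theorem ae_injective_of_affine {X E F : Type*} [NormedAddCommGroup X] [NormedSpace ℝ X]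
    [FiniteDimensional ℝ X] [MeasurableSpace X] [BorelSpace X] (μ : Measure X)
    [μ.IsAddHaarMeasure] [NormedAddCommGroup E] [NormedSpace ℝ E] [FiniteDimensional ℝ E]
    [NormedAddCommGroup F] [NormedSpace ℝ F]
    (c : E →ₗ[ℝ] F) (L : X →ₗ[ℝ] E →ₗ[ℝ] F) (p : X) (hp : Function.Injective (c + L p)) :
    ∀ᵐ x ∂μ, Function.Injective (c + L x) := by
  set Z : Set X := {y | ¬ Function.Injective (c + L p + L y)} with hZ
  have hclosed : IsClosed Z := by
    have hcont : Continuous fun y => LinearMap.toContinuousLinearMap (c + L p + L y) := by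
      simp only [map_add (LinearMap.toContinuousLinearMap (𝕜 := ℝ) (E := E) (F' := F))]
      exact continuous_const.add
        ((LinearMap.toContinuousLinearMap.toLinearMap ∘ₗ L).continuous_of_finiteDimensional)
    have := (ContinuousLinearMap.isOpen_injective (𝕜 := ℝ) (E := E) (F := F)).preimage hcont
    have h2 := this.isClosed_compl
    exact h2
  have hS : MeasurableSet {q : X × ℝ | q.2 • q.1 ∈ Z} :=
    (hclosed.preimage (by fun_prop : Continuous fun q : X × ℝ => q.2 • q.1)).measurableSet
  -- Every line through `p` meets the bad set in finitely many parameters. Exchanging the order of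
  -- integration gives one `t ≠ 0` such that `t • y` is good for almost every `y`; scaling by `t`
  -- and translating by `p` preserve null sets.
  have hprod : (μ.prod volume) {q : X × ℝ | q.2 • q.1 ∈ Z} = 0 := by
    rw [Measure.measure_prod_null hS]
    refine Eventually.of_forall fun y => ?_
    refine Set.Finite.measure_zero ?_ _
    refine (finite_setOf_not_injective_add_smul (c + L p) (L y) hp).subset fun t ht => ?_
    simpa only [hZ, Set.mem_ofPred_eq, Set.preimage_ofPred_eq, map_smul] using ht
  have hswap : (volume.prod μ) {q : ℝ × X | q.1 • q.2 ∈ Z} = 0 := by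
    rw [← Measure.prod_swap, Measure.map_apply measurable_swap]
    · exact hprod
    · exact (hclosed.preimage (by fun_prop : Continuous fun q : ℝ × X => q.1 • q.2)).measurableSet
  have hae := Measure.ae_ae_of_ae_prod (measure_eq_zero_iff_ae_notMem.1 hswap)
  have hne : ∀ᵐ t : ℝ, t ≠ 0 := by
    simp [ae_iff]
  obtain ⟨t, ht, ht0⟩ := (hae.and hne).exists
  have hZ0 : μ Z = 0 := by
    have h1 : μ ((t • ·) ⁻¹' Z) = 0 := measure_eq_zero_iff_ae_notMem.2 ht
    rw [Measure.addHaar_preimage_smul μ ht0] at h1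
    rcases mul_eq_zero.1 h1 with h | h
    · exfalso
      have : 0 < |(t ^ Module.finrank ℝ X)⁻¹| := by positivity
      exact absurd (ENNReal.ofReal_eq_zero.1 h) (not_le.2 this)
    · exact h
  have h2 : μ ((fun x => x + -p) ⁻¹' Z) = 0 := by rw [measure_preimage_add_right, hZ0]
  filter_upwards [measure_eq_zero_iff_ae_notMem.1 h2] with x hx
  by_contra hcon
  refine hx ?_
  have : c + L p + L (x + -p) = c + L x := by
    rw [map_add, map_neg]; abel
  change ¬ Function.Injective (c + L p + L (x + -p))
  rwa [this]

/-! ### Absolute continuity of the channel law -/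

lemma absolutelyContinuous_pi_fin {n : ℕ} {α : Fin n → Type*} [∀ i, MeasurableSpace (α i)]
    (μ ν : ∀ i, Measure (α i)) [∀ i, SigmaFinite (μ i)] [∀ i, SigmaFinite (ν i)]
    (h : ∀ i, μ i ≪ ν i) : Measure.pi μ ≪ Measure.pi ν := by
  induction n with
  | zero => rw [Measure.pi_of_empty μ, Measure.pi_of_empty ν]
  | succ n ih =>
    have hμ := (measurePreserving_piFinSuccAbove μ 0).symm.map_eq
    have hν := (measurePreserving_piFinSuccAbove ν 0).symm.map_eq
    rw [← hμ, ← hν]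
    exact ((h 0).prod (ih _ _ fun i => h _)).map (MeasurableEquiv.measurable _)

instance isProbabilityMeasure_complexGaussian (v : ℝ≥0) :
    IsProbabilityMeasure (complexGaussian v) :=
  Measure.isProbabilityMeasure_map (MeasurableEquiv.measurable _).aemeasurable

lemma complexGaussian_absolutelyContinuous {v : ℝ≥0} (hv : v ≠ 0) :
    complexGaussian v ≪ volume := by
  have hv2 : v / 2 ≠ 0 := by simpa using hv
  have h := ((gaussianReal_absolutelyContinuous 0 hv2).prod
    (gaussianReal_absolutelyContinuous 0 hv2)).map
    Complex.measurableEquivRealProd.symm.measurable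
  rw [← Measure.volume_eq_prod, Complex.volume_preserving_equiv_real_prod.symm.map_eq] at h
  exact h

lemma channelLaw_absolutelyContinuous (M N : Fin 2 → ℕ) {v : ℝ≥0} (hv : v ≠ 0) :
    channelLaw M N v ≪ volume :=
  absolutelyContinuous_pi_fin _ _ fun _ => absolutelyContinuous_pi_fin _ _ fun _ =>
    absolutelyContinuous_pi_fin _ _ fun _ => absolutelyContinuous_pi_fin _ _ fun _ =>
      complexGaussian_absolutelyContinuous hv

instance isAddHaarMeasure_volume_channel (M N : Fin 2 → ℕ) :
    (volume : Measure (Channel M N)).IsAddHaarMeasure := by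
  have h1 (m : ℕ) : (volume : Measure (Fin m → ℂ)).IsAddHaarMeasure :=
    Measure.pi.isAddHaarMeasure _
  have h2 (m n : ℕ) : (volume : Measure (Fin n → Fin m → ℂ)).IsAddHaarMeasure :=
    Measure.pi.isAddHaarMeasure _
  have h3 (r : Fin 2) :
      (volume : Measure ((t : Fin 2) → Fin (N r) → Fin (M t) → ℂ)).IsAddHaarMeasure :=
    Measure.pi.isAddHaarMeasure _
  exact Measure.pi.isAddHaarMeasure _

/-- `ae_injective_of_affine` for the law of the channel. -/
theorem ae_channel_injective {M N : Fin 2 → ℕ} {v : ℝ≥0} (hv : v ≠ 0) {E F : Type*}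
    [NormedAddCommGroup E] [NormedSpace ℝ E] [FiniteDimensional ℝ E]
    [NormedAddCommGroup F] [NormedSpace ℝ F]
    (c : E →ₗ[ℝ] F) (L : Channel M N →ₗ[ℝ] E →ₗ[ℝ] F) (p : Channel M N)
    (hp : Function.Injective (c + L p)) :
    ∀ᵐ H ∂channelLaw M N v, Function.Injective (c + L H) :=
  (channelLaw_absolutelyContinuous M N hv).ae_le (ae_injective_of_affine volume c L p hp)

/-! ### The alignment equations -/

/-- Extension of a vector by zero to a sequence. -/
def extendZero (R : Type*) [Semiring R] (n : ℕ) : (Fin n → R) →ₗ[R] ℕ → R where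
  toFun x m := if h : m < n then x ⟨m, h⟩ else 0
  map_add' x y := by ext m; by_cases h : m < n <;> simp [h]
  map_smul' c x := by ext m; by_cases h : m < n <;> simp [h]

lemma extendZero_coe {R : Type*} [Semiring R] {n : ℕ} (x : Fin n → R) (i : Fin n) :
    extendZero R n x i = x i := by simp [extendZero]

lemma extendZero_of_le {R : Type*} [Semiring R] {n m : ℕ} (x : Fin n → R) (h : n ≤ m) :
    extendZero R n x m = 0 := by simp [extendZero, h]

lemma eq_zero_of_extendZero {R : Type*} [Semiring R] {n : ℕ} {x : Fin n → R}
    (h : ∀ m < n, extendZero R n x m = 0) : x = 0 := by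
  ext i
  rw [← extendZero_coe x i, h i i.2, Pi.zero_apply]

/-- A real vector as a complex vector of another length, truncated or extended by zero. -/
def padReal (k n : ℕ) : (Fin k → ℝ) →ₗ[ℝ] Fin n → ℂ where
  toFun a i := (extendZero ℝ k a i : ℂ)
  map_add' x y := by ext; simp
  map_smul' c x := by ext; simp

lemma padReal_apply {k n : ℕ} (a : Fin k → ℝ) (i : Fin n) :
    padReal k n a i = (extendZero ℝ k a i : ℂ) := rfl

lemma padReal_eq_sum {k n : ℕ} (h : k ≤ n) (a : Fin k → ℝ) :
    padReal k n a = ∑ j, a j • (Pi.single (Fin.castLE h j) 1 : Fin n → ℂ) := by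
  ext i
  rw [padReal_apply, Finset.sum_apply]
  by_cases hi : (i : ℕ) < k
  · rw [Finset.sum_eq_single ⟨i, hi⟩]
    · have : Fin.castLE h ⟨i, hi⟩ = i := rfl
      simp [this, extendZero, hi]
    · intro j _ hj
      have : i ≠ Fin.castLE h j := fun e => hj (Fin.ext (by simp [e]))
      simp [this]
    · simp
  · rw [extendZero_of_le _ (not_lt.1 hi), Finset.sum_eq_zero]
    · simp
    · intro j _
      have : i ≠ Fin.castLE h j := fun e => hi (by simp [e])
      simp [this]

/-- The unknowns in `alignOffset` and `alignLinear`: the signals of both transmitters, their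
coordinates along the aligned directions, and the coordinates of the interference. -/
abbrev AlignDomain (M : Fin 2 → ℕ) (a b c : ℕ) : Type :=
  (Fin (M 0) → ℂ) × (Fin (M 1) → ℂ) × (Fin a → ℝ) × (Fin b → ℝ) × (Fin c → ℝ)

abbrev AlignCodomain (N : Fin 2 → ℕ) (r : Fin 2) : Type :=
  (Fin (N (1 - r)) → ℂ) × (Fin (N (1 - r)) → ℂ) × (Fin (N r) → ℂ)

/-- The part of the alignment equations that does not depend on the channel. -/
def alignOffset (M N : Fin 2 → ℕ) (r : Fin 2) (a b c : ℕ) :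
    AlignDomain M a b c →ₗ[ℝ] AlignCodomain N r where
  toFun y := (-padReal a _ y.2.2.1, -padReal b _ y.2.2.2.1, padReal c _ y.2.2.2.2)
  map_add' x y := by simp [add_comm]
  map_smul' s x := by simp

/-- The part of the alignment equations that is linear in the channel. -/
def alignLinear (M N : Fin 2 → ℕ) (r : Fin 2) (a b c : ℕ) :
    Channel M N →ₗ[ℝ] AlignDomain M a b c →ₗ[ℝ] AlignCodomain N r :=
  LinearMap.mk₂ ℝ (fun H y => (Matrix.of (H (1 - r) 0) *ᵥ y.1, Matrix.of (H (1 - r) 1) *ᵥ y.2.1,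
      Matrix.of (H r 0) *ᵥ y.1 + Matrix.of (H r 1) *ᵥ y.2.1))
    (fun H H' y => by
      simp only [Pi.add_apply, ← Matrix.of_add_of, Matrix.add_mulVec, Prod.mk_add_mk]
      congr 2; abel)
    (fun s H y => by
      simp only [Pi.smul_apply, ← Matrix.smul_of, Matrix.smul_mulVec, Prod.smul_mk, smul_add])
    (fun H y y' => by
      simp only [Prod.fst_add, Prod.snd_add, Matrix.mulVec_add, Prod.mk_add_mk]
      congr 2; abel)
    (fun s H y => by
      simp only [Prod.smul_fst, Prod.smul_snd, Matrix.mulVec_smul, Prod.smul_mk, smul_add])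

/-- The desired signals at receiver `r` can be separated from the interference: the alignment
equations have only the trivial solution. -/
def Separates {M N : Fin 2 → ℕ} (H : Channel M N) (r : Fin 2) (a b c : ℕ) : Prop :=
  ∀ (x₀ : Fin (M 0) → ℂ) (x₁ : Fin (M 1) → ℂ) (α : Fin a → ℝ) (β : Fin b → ℝ) (γ : Fin c → ℝ),
    Matrix.of (H (1 - r) 0) *ᵥ x₀ = padReal a _ α →
    Matrix.of (H (1 - r) 1) *ᵥ x₁ = padReal b _ β →
    Matrix.of (H r 0) *ᵥ x₀ + Matrix.of (H r 1) *ᵥ x₁ + padReal c _ γ = 0 →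
    x₀ = 0 ∧ x₁ = 0 ∧ α = 0 ∧ β = 0 ∧ γ = 0

/-- The signals themselves, constrained by the cross-link equations, are unknowns. No basis of a
null space enters, so the system stays affine in `H` and the genericity theorem applies. -/
lemma separates_iff {M N : Fin 2 → ℕ} (H : Channel M N) (r : Fin 2) (a b c : ℕ) :
    Separates H r a b c ↔ Function.Injective (alignOffset M N r a b c + alignLinear M N r a b c H) := by
  rw [← LinearMap.ker_eq_bot, LinearMap.ker_eq_bot']
  have key : ∀ y : AlignDomain M a b c,
      (alignOffset M N r a b c + alignLinear M N r a b c H) y = 0 ↔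
      Matrix.of (H (1 - r) 0) *ᵥ y.1 = padReal a _ y.2.2.1 ∧
      Matrix.of (H (1 - r) 1) *ᵥ y.2.1 = padReal b _ y.2.2.2.1 ∧
      Matrix.of (H r 0) *ᵥ y.1 + Matrix.of (H r 1) *ᵥ y.2.1 + padReal c _ y.2.2.2.2 = 0 := by
    intro y
    simp only [LinearMap.add_apply, alignOffset, alignLinear, LinearMap.mk₂_apply,
      LinearMap.coe_mk, AddHom.coe_mk, Prod.mk_add_mk, Prod.mk_eq_zero]
    rw [neg_add_eq_zero, neg_add_eq_zero, add_comm (padReal c _ _), eq_comm, @eq_comm _ (padReal b _ _)]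
  constructor
  · rintro h ⟨x₀, x₁, α, β, γ⟩ hy
    obtain ⟨h1, h2, h3⟩ := (key _).1 hy
    obtain ⟨rfl, rfl, rfl, rfl, rfl⟩ := h x₀ x₁ α β γ h1 h2 h3
    rfl
  · intro h x₀ x₁ α β γ h1 h2 h3
    simpa using h (x₀, x₁, α, β, γ) ((key _).2 ⟨h1, h2, h3⟩)

/-! ### A channel with separated signals -/

/-- A transmitter whose first `p` antennas feed `len` real dimensions, starting with number `s`
in the real basis `e₁, …, e_d, j e₁, …, j e_d`, and whose other antennas feed, from position `o`
on, the complex subspace spanned by the vectors `e_{d+m} - j e_m`. -/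
def stackedMap (p d s len o m q : ℕ) : (Fin m → ℂ) →ₗ[ℂ] Fin q → ℂ where
  toFun x i :=
    let y := extendZero ℂ m x
    let β := fun k : ℕ => if s ≤ k ∧ k < s + len then y (k - s) else 0
    let τ := fun k : ℕ => if o ≤ k then y (p + (k - o)) else 0
    if (i : ℕ) < d then β i + Complex.I * β (i + d) - Complex.I * τ i else τ (i - d)
  map_add' x y := by
    ext i
    simp only [map_add, Pi.add_apply]
    split_ifs <;> ring
  map_smul' c x := by
    ext i
    simp only [map_smul, Pi.smul_apply, smul_eq_mul, RingHom.id_apply]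
    split_ifs <;> ring

lemma stackedMap_apply (p d s len o m q : ℕ) (x : Fin m → ℂ) (i : Fin q) :
    stackedMap p d s len o m q x i =
      if (i : ℕ) < d then
        (if s ≤ (i : ℕ) ∧ (i : ℕ) < s + len then extendZero ℂ m x (i - s) else 0) +
        Complex.I * (if s ≤ (i : ℕ) + d ∧ (i : ℕ) + d < s + len then
          extendZero ℂ m x (i + d - s) else 0) -
        Complex.I * (if o ≤ (i : ℕ) then extendZero ℂ m x (p + (i - o)) else 0)
      else (if o ≤ (i : ℕ) - d then extendZero ℂ m x (p + (i - d - o)) else 0) := rfl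

/-- The channel in which the cross links to receiver `1 - r` are coordinate projections and the
links to receiver `r` are stacked. -/
def stackedChannel (M N : Fin 2 → ℕ) (r : Fin 2) (a b c d : ℕ) : Channel M N :=
  Function.update (fun _ _ i j => if (i : ℕ) = j then 1 else 0) r fun t i j =>
    LinearMap.toMatrix' (stackedMap (N (1 - r)) d (if t = 0 then c else c + a)
      (if t = 0 then a else b) (if t = 0 then 0 else M 0 - N (1 - r)) (M t) (N r)) i j

lemma one_sub_ne (r : Fin 2) : 1 - r ≠ r := by fin_cases r <;> decide

lemma stackedChannel_mulVec_self (M N : Fin 2 → ℕ) (r t : Fin 2) (a b c d : ℕ) (x : Fin (M t) → ℂ) :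
    Matrix.of (stackedChannel M N r a b c d r t) *ᵥ x =
      stackedMap (N (1 - r)) d (if t = 0 then c else c + a)
      (if t = 0 then a else b) (if t = 0 then 0 else M 0 - N (1 - r)) (M t) (N r) x := by
  rw [stackedChannel, Function.update_self]
  exact LinearMap.congr_fun (Matrix.toLin'_toMatrix' (stackedMap (N (1 - r)) d _ _ _ (M t) (N r))) x

lemma truncation_mulVec {m n : ℕ} (x : Fin m → ℂ) (i : Fin n) :
    (Matrix.of (fun (i : Fin n) (j : Fin m) => if (i : ℕ) = j then (1 : ℂ) else 0) *ᵥ x) i =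
      extendZero ℂ m x i := by
  simp only [Matrix.mulVec, dotProduct, Matrix.of_apply, ite_mul, one_mul, zero_mul]
  by_cases h : (i : ℕ) < m
  · rw [Finset.sum_eq_single ⟨i, h⟩]
    · simp [extendZero, h]
    · intro j _ hj
      rw [if_neg fun e => hj (Fin.ext e.symm)]
    · simp
  · rw [extendZero_of_le _ (not_lt.1 h), Finset.sum_eq_zero]
    intro j _
    rw [if_neg]
    have := j.2
    omega

lemma stackedChannel_mulVec_cross (M N : Fin 2 → ℕ) (r t : Fin 2) (a b c d : ℕ)
    (x : Fin (M t) → ℂ) (i : Fin (N (1 - r))) :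
    (Matrix.of (stackedChannel M N r a b c d (1 - r) t) *ᵥ x) i = extendZero ℂ (M t) x i := by
  rw [stackedChannel, Function.update_of_ne (one_sub_ne r)]
  exact truncation_mulVec x i

/-- The coordinate form of `separates_stackedChannel`. -/
lemma stacked_eq_zero {p q m₀ m₁ a b c d : ℕ} (hM0 : p ≤ m₀) (hM1 : p ≤ m₁)
    (hd : m₀ + m₁ + d = q + 2 * p) (ha : a ≤ p) (hb : b ≤ p) (hc : c ≤ q)
    (habc : a + b + c = 2 * d) {X Y : ℕ → ℂ} {α β γ : ℕ → ℝ}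
    (hX : ∀ k, m₀ ≤ k → X k = 0) (hY : ∀ k, m₁ ≤ k → Y k = 0)
    (hγ : ∀ k, c ≤ k → γ k = 0)
    (hXα : ∀ k < p, X k = α k) (hYβ : ∀ k < p, Y k = β k)
    (h : ∀ i < q,
      (if i < d then
        (if c ≤ i ∧ i < c + a then X (i - c) else 0) +
        Complex.I * (if c ≤ i + d ∧ i + d < c + a then X (i + d - c) else 0) -
        Complex.I * X (p + i)
      else X (p + (i - d))) +
      (if i < d then
        (if c + a ≤ i ∧ i < c + a + b then Y (i - (c + a)) else 0) +
        Complex.I * (if c + a ≤ i + d ∧ i + d < c + a + b then Y (i + d - (c + a)) else 0) -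
        Complex.I * (if m₀ - p ≤ i then Y (p + (i - (m₀ - p))) else 0)
      else (if m₀ - p ≤ i - d then Y (p + (i - d - (m₀ - p))) else 0)) + γ i = 0) :
    (∀ k < a, α k = 0) ∧ (∀ k < b, β k = 0) ∧ (∀ k < c, γ k = 0) ∧
      (∀ k, p ≤ k → k < m₀ → X k = 0) ∧ (∀ k, p ≤ k → k < m₁ → Y k = 0) := by
  -- The supports `[0, c)`, `[c, c + a)` and `[c + a, 2 * d)` of interference and aligned signals
  -- are disjoint, so `ρ = 0` kills each of them separately.
  set ρ : ℕ → ℝ := fun m => (if c ≤ m ∧ m < c + a then α (m - c) else 0) +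
    (if c + a ≤ m ∧ m < c + a + b then β (m - (c + a)) else 0) + γ m with hρ
  have hXα' : ∀ m, (if c ≤ m ∧ m < c + a then X (m - c) else 0) =
      ((if c ≤ m ∧ m < c + a then α (m - c) else 0 : ℝ) : ℂ) := by
    intro m
    split_ifs with hm
    · exact hXα _ (by omega)
    · simp
  have hYβ' : ∀ m, (if c + a ≤ m ∧ m < c + a + b then Y (m - (c + a)) else 0) =
      ((if c + a ≤ m ∧ m < c + a + b then β (m - (c + a)) else 0 : ℝ) : ℂ) := by
    intro m
    split_ifs with hm
    · exact hYβ _ (by omega)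
    · simp
  have hdq : d ≤ q := by omega
  have hpair : ∀ i < d, (ρ i : ℂ) + Complex.I * ρ (i + d) = 0 := by
    intro i hi
    have hi1 := h i (by omega)
    rw [if_pos hi, if_pos hi, hXα' i, hXα' (i + d), hYβ' i, hYβ' (i + d)] at hi1
    -- Row `i + d` determines the tail terms appearing in row `i`. If that row does not exist, the
    -- indices lie beyond both transmitters' antennas and every term is zero.
    have htail : X (p + i) + (if m₀ - p ≤ i then Y (p + (i - (m₀ - p))) else 0) +
        γ (i + d) = 0 := by
      by_cases hiq : i + d < q
      · have hi2 := h (i + d) hiq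
        rwa [if_neg (by omega), if_neg (by omega), Nat.add_sub_cancel] at hi2
      · rw [hX _ (by omega), hγ _ (by omega), if_pos (by omega), hY _ (by omega)]
        simp
    simp only [hρ]
    push_cast at hi1 ⊢
    linear_combination hi1 + Complex.I * htail
  have hzero : ∀ m < 2 * d, ρ m = 0 := by
    intro m hm
    by_cases hmd : m < d
    · simpa using congrArg Complex.re (hpair m hmd)
    · have := congrArg Complex.im (hpair (m - d) (by omega))
      rw [Nat.sub_add_cancel (not_lt.1 hmd)] at this
      simpa using this
  have hα : ∀ k < a, α k = 0 := by
    intro k hk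
    have := hzero (c + k) (by omega)
    simp only [hρ] at this
    rw [if_pos (by omega), if_neg (by omega), hγ _ (by omega), Nat.add_sub_cancel_left] at this
    simpa using this
  have hβ : ∀ k < b, β k = 0 := by
    intro k hk
    have := hzero (c + a + k) (by omega)
    simp only [hρ] at this
    rw [if_neg (by omega), if_pos (by omega), hγ _ (by omega), Nat.add_sub_cancel_left] at this
    simpa using this
  have hγ0 : ∀ k, γ k = 0 := by
    intro k
    by_cases hk : k < c
    · have := hzero k (by omega)
      simp only [hρ] at this
      rw [if_neg (by omega), if_neg (by omega)] at this
      simpa using this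
    · exact hγ k (not_lt.1 hk)
  have htail : ∀ m < q - d, X (p + m) + (if m₀ - p ≤ m then Y (p + (m - (m₀ - p))) else 0) = 0 := by
    intro m hm
    have := h (m + d) (by omega)
    rw [if_neg (by omega), if_neg (by omega), Nat.add_sub_cancel, hγ0] at this
    simpa using this
  refine ⟨hα, hβ, fun k _ => hγ0 k, fun k hpk hk => ?_, fun k hpk hk => ?_⟩
  · have := htail (k - p) (by omega)
    rw [if_neg (by omega), Nat.add_sub_cancel' hpk] at this
    simpa using this
  · have := htail (m₀ - p + (k - p)) (by omega)
    rw [if_pos (by omega), Nat.add_sub_cancel_left, Nat.add_sub_cancel' hpk, hX _ (by omega)]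
      at this
    simpa using this

/-- The free antennas fill `N r - d` complex dimensions, leaving a quotient of real dimension `2 * d
= a + b + c`. In it `e_{d+m}` becomes `j e_m` for `m < d`, so interference along real unit vectors
beyond the first `d` continues the real basis with `j e_1, j e_2, …`, and the aligned signals take
the remaining basis vectors. -/
theorem separates_stackedChannel (M N : Fin 2 → ℕ) (r : Fin 2) {a b c d : ℕ}
    (hM0 : N (1 - r) ≤ M 0) (hM1 : N (1 - r) ≤ M 1) (hd : M 0 + M 1 + d = N r + 2 * N (1 - r))
    (ha : a ≤ N (1 - r)) (hb : b ≤ N (1 - r)) (hc : c ≤ N r) (habc : a + b + c = 2 * d) :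
    Separates (stackedChannel M N r a b c d) r a b c := by
  intro x₀ x₁ α β γ h0 h1 h2
  have hX : ∀ k < N (1 - r), extendZero ℂ _ x₀ k = extendZero ℝ _ α k := fun k hk => by
    rw [← stackedChannel_mulVec_cross M N r 0 a b c d x₀ ⟨k, hk⟩, h0, padReal_apply]
  have hY : ∀ k < N (1 - r), extendZero ℂ _ x₁ k = extendZero ℝ _ β k := fun k hk => by
    rw [← stackedChannel_mulVec_cross M N r 1 a b c d x₁ ⟨k, hk⟩, h1, padReal_apply]
  rw [stackedChannel_mulVec_self, stackedChannel_mulVec_self] at h2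
  obtain ⟨hα, hβ, hγ, hX0, hY0⟩ := stacked_eq_zero hM0 hM1 hd ha hb hc habc
    (fun k hk => extendZero_of_le x₀ hk) (fun k hk => extendZero_of_le x₁ hk)
    (fun k hk => extendZero_of_le γ hk) hX hY (fun i hi => by
      have := congrFun h2 ⟨i, hi⟩
      simpa [stackedMap_apply, padReal_apply] using this)
  have hα0 := eq_zero_of_extendZero hα
  have hβ0 := eq_zero_of_extendZero hβ
  refine ⟨eq_zero_of_extendZero fun k hk => ?_, eq_zero_of_extendZero fun k hk => ?_, hα0, hβ0,
    eq_zero_of_extendZero hγ⟩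
  · by_cases hkp : k < N (1 - r)
    · rw [hX k hkp, hα0]; simp
    · exact hX0 k (not_lt.1 hkp) hk
  · by_cases hkp : k < N (1 - r)
    · rw [hY k hkp, hβ0]; simp
    · exact hY0 k (not_lt.1 hkp) hk

/-- For almost every channel, receiver `r` can separate `a + b` aligned desired dimensions,
the zero-forced signals, and `c` interference dimensions. -/
theorem ae_separates {M N : Fin 2 → ℕ} {v : ℝ≥0} (hv : v ≠ 0) (r : Fin 2) {a b c d : ℕ}
    (hM0 : N (1 - r) ≤ M 0) (hM1 : N (1 - r) ≤ M 1) (hd : M 0 + M 1 + d = N r + 2 * N (1 - r))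
    (ha : a ≤ N (1 - r)) (hb : b ≤ N (1 - r)) (hc : c ≤ N r) (habc : a + b + c = 2 * d) :
    ∀ᵐ H ∂channelLaw M N v, Separates H r a b c := by
  simp only [separates_iff]
  exact ae_channel_injective hv _ _ _
    ((separates_iff _ _ _ _ _).1 (separates_stackedChannel M N r hM0 hM1 hd ha hb hc habc))

/-! ### Schemes from separated signals -/

/-- For almost every channel, the link from transmitter `t` to receiver `r` is onto. -/
theorem ae_mulVec_surjective {M N : Fin 2 → ℕ} {v : ℝ≥0} (hv : v ≠ 0) (r t : Fin 2)
    (h : N r ≤ M t) :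
    ∀ᵐ H ∂channelLaw M N v, Function.Surjective (Matrix.of (H r t)).mulVec := by
  -- Surjectivity is rephrased as injectivity of the action on row vectors, which is linear in the
  -- channel.
  let L : Channel M N →ₗ[ℝ] (Fin (N r) → ℂ) →ₗ[ℝ] (Fin (M t) → ℂ) :=
    LinearMap.mk₂ ℝ (fun H y => y ᵥ* Matrix.of (H r t))
      (fun H H' y => by simp only [Pi.add_apply, ← Matrix.of_add_of, Matrix.vecMul_add])
      (fun s H y => by simp only [Pi.smul_apply, ← Matrix.smul_of, Matrix.vecMul_smul])
      (fun H y y' => by simp only [Matrix.add_vecMul])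
      (fun s H y => by simp only [Matrix.smul_vecMul])
  have hp : Function.Injective ((0 : (Fin (N r) → ℂ) →ₗ[ℝ] (Fin (M t) → ℂ)) +
      L fun _ _ i j => if (i : ℕ) = j then 1 else 0) := by
    rw [zero_add, ← LinearMap.ker_eq_bot, LinearMap.ker_eq_bot']
    intro y hy
    ext i
    have := congrFun hy (Fin.castLE h i)
    simpa [L, Matrix.vecMul, dotProduct, Fin.ext_iff, ← Fin.ext_iff] using this
  filter_upwards [ae_channel_injective hv 0 L _ hp] with H hH
  rw [zero_add] at hH
  have hrow : LinearIndependent ℂ (Matrix.of (H r t)).row := Matrix.vecMul_injective_iff.1 hH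
  rw [← Matrix.coe_mulVecLin, ← LinearMap.range_eq_top]
  apply Submodule.eq_top_of_finrank_eq
  have := hrow.rank_matrix
  simpa [Matrix.rank] using this

lemma finrank_ker_mulVecLin_of_surjective {m n : ℕ} (A : Matrix (Fin n) (Fin m) ℂ)
    (hA : Function.Surjective A.mulVec) :
    Module.finrank ℂ (LinearMap.ker A.mulVecLin) = m - n := by
  have h := A.mulVecLin.finrank_range_add_finrank_ker
  have htop : LinearMap.range A.mulVecLin = ⊤ := LinearMap.range_eq_top.2 hA
  rw [htop, finrank_top, Module.finrank_fin_fun, Module.finrank_fin_fun] at h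
  omega

lemma exists_linearIndependent_null {m n : ℕ} (A : Matrix (Fin n) (Fin m) ℂ)
    (hA : Function.Surjective A.mulVec) :
    ∃ v : Fin (m - n) → Fin m → ℂ, LinearIndependent ℂ v ∧ ∀ k, A *ᵥ v k = 0 := by
  let B := Module.finBasisOfFinrankEq ℂ _ (finrank_ker_mulVecLin_of_surjective A hA)
  exact ⟨fun k => (B k : Fin m → ℂ),
    B.linearIndependent.map' (Submodule.subtype _) (Submodule.ker_subtype _),
    fun k => LinearMap.mem_ker.1 (B k).2⟩

/-- Block lengths that use the whole null spaces of the cross links twice, and third blocks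
of lengths `u`. -/
def nullBlocks (M N : Fin 2 → ℕ) (u : Fin 2 → Fin 2 → ℕ) : BlockLengths :=
  fun r t => ![M t - N (1 - r), M t - N (1 - r), u r t]

def nullPrecoders {M N : Fin 2 → ℕ} {u : Fin 2 → Fin 2 → ℕ}
    (V : (r t : Fin 2) → Fin (M t - N (1 - r)) → Fin (M t) → ℂ)
    (U : (r t : Fin 2) → Fin (u r t) → Fin (M t) → ℂ) : Precoders M (nullBlocks M N u) :=
  fun r t i => match i with
    | 0 => V r t
    | 1 => fun k => Complex.I • V r t k
    | 2 => U r t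

/-- Sending the third blocks of both transmitters to the same unit vectors makes them aligned. A
real dependence at receiver `r` is then a solution of the alignment equations, hence trivial. -/
theorem exists_isScheme {M N : Fin 2 → ℕ} {H : Channel M N} (u : Fin 2 → Fin 2 → ℕ)
    (hsurj : ∀ r t, Function.Surjective (Matrix.of (H r t)).mulVec)
    (hu : ∀ r t, u r t ≤ N (1 - r)) (hle : ∀ r, u r 0 ≤ u r 1)
    (hsep : ∀ r, Separates H r (u r 0) (u r 1) (u (1 - r) 1)) :
    ∃ P : Precoders M (nullBlocks M N u), IsScheme H _ P := by
  choose V hVi hV0 using fun r t => exists_linearIndependent_null _ (hsurj (1 - r) t)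
  choose U hU using fun r t (k : Fin (u r t)) =>
    hsurj (1 - r) t (Pi.single (Fin.castLE (hu r t) k) 1)
  have hU' : ∀ r r' t (h : r' = 1 - r) (k : Fin (u r t)), Matrix.of (H r' t) *ᵥ U r t k =
      Pi.single (Fin.castLE (h ▸ hu r t) k) 1 := by
    rintro r r' t rfl k
    exact hU r t k
  refine ⟨nullPrecoders V U, ⟨hVi, hV0, fun _ _ => le_rfl, fun _ _ _ => rfl, ?_, hle, ?_, ?_⟩⟩
  · intro r t
    have : (fun k => Matrix.of (H (1 - r) t) *ᵥ U r t k) =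
        fun k => (Pi.single (Fin.castLE (hu r t) k) 1 : Fin (N (1 - r)) → ℂ) := by
      ext1 k; exact hU r t k
    change LinearIndependent ℂ (fun k => Matrix.of (H (1 - r) t) *ᵥ U r t k)
    rw [this]
    have h := (Pi.basisFun ℂ (Fin (N (1 - r)))).linearIndependent.comp _
      (Fin.castLE_injective (hu r t))
    convert h using 1
    ext1 k
    simp
  · intro r (k : Fin (u r 0))
    change Submodule.span ℝ {Matrix.of (H (1 - r) 1) *ᵥ U r 1 (Fin.castLE (hle r) k)} =
      Submodule.span ℝ {Matrix.of (H (1 - r) 0) *ᵥ U r 0 k}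
    rw [hU, hU]
    rfl
  · intro r
    rw [Fintype.linearIndependent_iff]
    intro g hg
    rw [Fintype.sum_sum_type, Fintype.sum_sigma, Fin.sum_univ_two] at hg
    simp only [Sum.elim_inl, Sum.elim_inr] at hg
    set x : (t : Fin 2) → Fin (M t) → ℂ := fun t =>
      ∑ q : Stream (nullBlocks M N u) r t, g (Sum.inl ⟨t, q⟩) • nullPrecoders V U r t q.1 q.2 with hx
    have hHx : ∀ r' t, Matrix.of (H r' t) *ᵥ x t =
        ∑ q : Stream (nullBlocks M N u) r t, g (Sum.inl ⟨t, q⟩) •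
          Matrix.of (H r' t) *ᵥ nullPrecoders V U r t q.1 q.2 := by
      intro r' t
      simp only [hx, Matrix.mulVec_sum, Matrix.mulVec_smul]
    obtain ⟨gv, hgv⟩ : ∃ f : (t : Fin 2) → Fin (M t - N (1 - r)) → ℝ,
      ∀ t k, f t k = g (Sum.inl ⟨t, 0, k⟩) := ⟨fun t k => g (Sum.inl ⟨t, 0, k⟩), fun _ _ => rfl⟩
    obtain ⟨gw, hgw⟩ : ∃ f : (t : Fin 2) → Fin (M t - N (1 - r)) → ℝ,
      ∀ t k, f t k = g (Sum.inl ⟨t, 1, k⟩) := ⟨fun t k => g (Sum.inl ⟨t, 1, k⟩), fun _ _ => rfl⟩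
    obtain ⟨gu, hgu⟩ : ∃ f : (t : Fin 2) → Fin (u r t) → ℝ,
      ∀ t k, f t k = g (Sum.inl ⟨t, 2, k⟩) := ⟨fun t k => g (Sum.inl ⟨t, 2, k⟩), fun _ _ => rfl⟩
    have hxs : ∀ t, x t = ∑ k, gv t k • V r t k + ∑ k, gw t k • Complex.I • V r t k +
        ∑ k, gu t k • U r t k := by
      intro t
      simp only [hx]
      rw [Fintype.sum_sigma, Fin.sum_univ_three]
      simp only [hgv, hgw, hgu]
      rfl
    have hcross : ∀ t, Matrix.of (H (1 - r) t) *ᵥ x t =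
        padReal (u r t) _ (gu t) := by
      intro t
      rw [hxs, padReal_eq_sum (hu r t)]
      simp only [Matrix.mulVec_add, Matrix.mulVec_sum, Matrix.mulVec_smul, hV0, hU, smul_zero,
        Finset.sum_const_zero, zero_add]
    have hint : ∑ k, g (Sum.inr k) • Matrix.of (H r 1) *ᵥ nullPrecoders V U (1 - r) 1 2 k =
        padReal (u (1 - r) 1) (N r) fun k => g (Sum.inr k) := by
      have h1 : r = 1 - (1 - r) := by simp
      rw [padReal_eq_sum ((hu (1 - r) 1).trans_eq (by rw [← h1]))]
      exact Finset.sum_congr rfl fun k _ => by rw [← hU' (1 - r) r 1 h1 k]; rfl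
    rw [← hHx, ← hHx, hint] at hg
    obtain ⟨h0, h1, h2, h3, h4⟩ := hsep r _ _ _ _ _ (hcross 0) (hcross 1) hg
    have hxt : ∀ t, x t = 0 := Fin.forall_fin_two.2 ⟨h0, h1⟩
    have hgu0 : ∀ t, gu t = 0 := Fin.forall_fin_two.2 ⟨h2, h3⟩
    have hgvw : ∀ t k, gv t k = 0 ∧ gw t k = 0 := by
      intro t k
      have h5 := hxs t
      simp only [hxt, hgu0, Pi.zero_apply, zero_smul, Finset.sum_const_zero, add_zero] at h5
      rw [← Finset.sum_add_distrib] at h5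
      -- The real coefficients of `v` and `j v` are the real and imaginary parts of one complex
      -- coefficient, so complex independence of the `v` suffices.
      have h6 := Fintype.linearIndependent_iff.1 (hVi r t)
        (fun k => (gv t k : ℂ) + gw t k * Complex.I)
        (by
          rw [h5]
          refine Finset.sum_congr rfl fun k _ => ?_
          rw [add_smul, mul_smul]
          rfl) k
      exact ⟨by simpa using congrArg Complex.re h6, by simpa using congrArg Complex.im h6⟩
    rintro (⟨t, i, k⟩ | k)
    · fin_cases i
      · exact (hgv t k).symm.trans (hgvw t k).1
      · exact (hgw t k).symm.trans (hgvw t k).2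
      · exact (hgu t k).symm.trans (congrFun (hgu0 t) k)
    · exact congrFun h4 k

/-! ### Rounding and the upper bound on message lengths -/

lemma floor_two_mul_div_three (x : ℤ) : ⌊(2 * x / 3 : ℚ)⌋ = 2 * x / 3 := by
  obtain ⟨h1, h2⟩ : 3 * (2 * x / 3) ≤ 2 * x ∧ 2 * x < 3 * (2 * x / 3) + 3 := by omega
  generalize 2 * x / 3 = z at *
  have h1' : (3 * z : ℚ) ≤ 2 * x := by exact_mod_cast h1
  have h2' : (2 * x : ℚ) < 3 * z + 3 := by exact_mod_cast h2
  exact Int.floor_eq_iff.2 ⟨by linarith, by linarith⟩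

lemma floor_div_three (x : ℤ) : ⌊(x / 3 : ℚ)⌋ = x / 3 := by
  obtain ⟨h1, h2⟩ : 3 * (x / 3) ≤ x ∧ x < 3 * (x / 3) + 3 := by omega
  generalize x / 3 = z at *
  have h1' : (3 * z : ℚ) ≤ x := by exact_mod_cast h1
  have h2' : (x : ℚ) < 3 * z + 3 := by exact_mod_cast h2
  exact Int.floor_eq_iff.2 ⟨by linarith, by linarith⟩

lemma ceil_sub_one_div_three (x : ℤ) : ⌈((x - 1) / 3 : ℚ)⌉ = (x + 1) / 3 := by
  obtain ⟨h1, h2⟩ : 3 * ((x + 1) / 3) < x + 2 ∧ x ≤ 3 * ((x + 1) / 3) + 1 := by omega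
  generalize (x + 1) / 3 = z at *
  have h1' : (3 * z : ℚ) < x + 2 := by exact_mod_cast h1
  have h2' : (x : ℚ) ≤ 3 * z + 1 := by exact_mod_cast h2
  exact Int.ceil_eq_iff.2 ⟨by linarith, by linarith⟩

variable {M N : Fin 2 → ℕ} {H : Channel M N} {b : BlockLengths} {P : Precoders M b}

lemma IsScheme.length_null_le (hS : IsScheme H b P) (r t : Fin 2)
    (hsurj : Function.Surjective (Matrix.of (H (1 - r) t)).mulVec) :
    b r t 0 ≤ M t - N (1 - r) := by
  rw [← finrank_ker_mulVecLin_of_surjective _ hsurj]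
  have h : LinearIndependent ℂ fun k => (⟨P r t 0 k, LinearMap.mem_ker.2 (hS.null_v r t k)⟩ :
      LinearMap.ker (Matrix.of (H (1 - r) t)).mulVecLin) :=
    LinearIndependent.of_comp (Submodule.subtype _) (hS.indep_v r t)
  simpa using h.fintype_card_le_finrank

lemma IsScheme.length_rx_le (hS : IsScheme H b P) (r : Fin 2) :
    msgLength b r 0 + msgLength b r 1 + b (1 - r) 1 2 ≤ 2 * N r := by
  have h := (hS.indep_rx r).fintype_card_le_finrank
  have hN : Module.finrank ℝ (Fin (N r) → ℂ) = 2 * N r := by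
    rw [Module.finrank_pi_fintype]
    simp [Complex.finrank_real_complex, mul_comm]
  rw [hN] at h
  simpa [msgLength, Fin.sum_univ_two] using h

/-- The outer bound on the total message length of a scheme. -/
theorem IsScheme.three_mul_sum_le (hS : IsScheme H b P)
    (hsurj : ∀ r t, Function.Surjective (Matrix.of (H r t)).mulVec)
    (hN : ∀ r t, N r ≤ M t) :
    3 * ∑ r, ∑ t, msgLength b r t ≤ 4 * (M 0 + M 1) := by
  have h1 := hS.length_rx_le 0
  have h2 := hS.length_rx_le 1
  have h3 : ∀ r t, b r t 0 + N (1 - r) ≤ M t := fun r t =>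
    (Nat.le_sub_iff_add_le (hN _ t)).1 (hS.length_null_le r t (hsurj (1 - r) t))
  have h4 := hS.le_v
  have h5 := hS.le_u
  simp only [Fin.forall_fin_two, Fin.isValue, sub_zero, sub_self] at h3 h4 h5
  simp only [Fin.sum_univ_two, msgLength, Fin.sum_univ_three, Fin.isValue, sub_zero,
    sub_self] at h1 h2 ⊢
  obtain ⟨⟨h300, h301⟩, h310, h311⟩ := h3
  obtain ⟨⟨h400, h401⟩, h410, h411⟩ := h4
  -- Twice the sum of the receiver bounds, with third blocks bounded by `le_u` and second blocks by
  -- `le_v`, gives three times the total at most `4 * (N 0 + N 1)` plus twice the sum of the first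
  -- block lengths. The latter sum is at most `2 * (M 0 + M 1) - 2 * (N 0 + N 1)`, so the receive
  -- antennas cancel.
  linarith

/-! ### The optimal block lengths -/

/-- Lengths of the third blocks of the optimal scheme. -/
def alignedLengths (N : Fin 2 → ℕ) (x : ℕ) (r t : Fin 2) : ℕ :=
  if r = 0 then (if t = 0 then 2 * x / 3 else x - (x + 1) / 3)
  else 2 * (N 0 - N 1) + if t = 0 then 2 * x / 3 else x - x / 3

theorem ae_exists_isScheme (M N : Fin 2 → ℕ) (hM10 : M 1 ≤ M 0) (hMN : N 0 ≤ M 1)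
    (hN10 : N 1 ≤ N 0) (v : ℝ≥0) (hv : v ≠ 0) (x : ℕ) (hx : x + (M 0 + M 1) = 3 * N 1) :
    ∀ᵐ H ∂channelLaw M N v, ∃ P : Precoders M (nullBlocks M N (alignedLengths N x)),
      IsScheme H _ P := by
  have hMN' : ∀ r t, N r ≤ M t := by
    simp only [Fin.forall_fin_two]
    omega
  -- Here `d = N r + 2 * N (1 - r) - (M 0 + M 1)` is what the nulled signals leave free at receiver
  -- `r`. That `a + b + c = 2 * d` rests on `2 * x / 3 = (x + 1) / 3 + x / 3` for integer division.
  have h0 := ae_separates (M := M) (N := N) hv 0 (a := alignedLengths N x 0 0)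
    (b := alignedLengths N x 0 1) (c := alignedLengths N x 1 1) (d := N 0 - N 1 + x)
    (hMN' _ _) (hMN' _ _)
    (by simp; omega)
    (by simp [alignedLengths]; omega) (by simp [alignedLengths]; omega)
    (by simp [alignedLengths]; omega) (by simp [alignedLengths]; omega)
  have h1 := ae_separates (M := M) (N := N) hv 1 (a := alignedLengths N x 1 0)
    (b := alignedLengths N x 1 1) (c := alignedLengths N x 0 1) (d := 2 * (N 0 - N 1) + x)
    (hMN' _ _) (hMN' _ _)
    (by simp; omega)
    (by simp [alignedLengths]; omega) (by simp [alignedLengths]; omega)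
    (by simp [alignedLengths]; omega) (by simp [alignedLengths]; omega)
  have hs : ∀ᵐ H ∂channelLaw M N v, ∀ r t, Function.Surjective (Matrix.of (H r t)).mulVec :=
    ae_all_iff.2 fun r => ae_all_iff.2 fun t => ae_mulVec_surjective hv r t (hMN' r t)
  filter_upwards [h0, h1, hs] with H h0 h1 hs
  refine exists_isScheme _ hs ?_ ?_ ?_
  · simp only [Fin.forall_fin_two]
    simp [alignedLengths]
    omega
  · simp only [Fin.forall_fin_two]
    simp [alignedLengths]
    omega
  · exact Fin.forall_fin_two.2 ⟨h0, h1⟩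

/-! ### Concentration of the noise -/

lemma memLp_id_complexGaussian (v : ℝ≥0) : MemLp id 2 (complexGaussian v) := by
  rw [complexGaussian, memLp_map_measure_iff measurable_id.aestronglyMeasurable
    (MeasurableEquiv.measurable _).aemeasurable]
  have h1 : MemLp (fun p : ℝ × ℝ => ((p.1 : ℝ) : ℂ)) 2
      ((gaussianReal 0 (v / 2)).prod (gaussianReal 0 (v / 2))) :=
    ((memLp_id_gaussianReal 2).comp_measurePreserving measurePreserving_fst).ofReal
  have h2 : MemLp (fun p : ℝ × ℝ => ((p.2 : ℝ) : ℂ)) 2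
      ((gaussianReal 0 (v / 2)).prod (gaussianReal 0 (v / 2))) :=
    ((memLp_id_gaussianReal 2).comp_measurePreserving measurePreserving_snd).ofReal
  convert h1.add (h2.const_mul Complex.I) using 1
  ext p
  simp only [Function.comp, id, Pi.add_apply]
  exact (Complex.mk_eq_add_mul_I _ _).trans (by ring)

lemma memLp_norm_pi_complexGaussian (v : ℝ≥0) (a : ℕ) :
    MemLp (fun z : Fin a → ℂ => ‖z‖) 2 (Measure.pi fun _ => complexGaussian v) := by
  have h : MemLp (fun z : Fin a → ℂ => ∑ i, ‖z i‖) 2 (Measure.pi fun _ => complexGaussian v) :=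
    memLp_finsetSum _ fun i _ => ((memLp_id_complexGaussian v).comp_measurePreserving
      (measurePreserving_eval (fun _ : Fin a => complexGaussian v) i)).norm
  refine h.mono measurable_norm.aestronglyMeasurable (Eventually.of_forall fun z => ?_)
  rw [norm_norm, Real.norm_of_nonneg (Finset.sum_nonneg fun _ _ => norm_nonneg _)]
  refine (pi_norm_le_iff_of_nonneg (Finset.sum_nonneg fun _ _ => norm_nonneg _)).2 fun i => ?_
  exact Finset.single_le_sum (f := fun i => ‖z i‖) (fun _ _ => norm_nonneg _) (Finset.mem_univ i)

/-- The average noise amplitude of a long block is bounded with high probability. -/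
lemma exists_noise_bound (a : ℕ) : ∃ c : ℝ, 0 < c ∧ ∀ ε : ℝ, 0 < ε → ∃ n₀ : ℕ, ∀ n ≥ n₀,
    noiseLaw n a {z | c * n < ∑ s, ‖z s‖} ≤ ENNReal.ofReal ε := by
  set μ : Measure (Fin a → ℂ) := Measure.pi fun _ => complexGaussian 1 with hμ
  set X : (Fin a → ℂ) → ℝ := fun z => ‖z‖
  have hX : MemLp X 2 μ := memLp_norm_pi_complexGaussian 1 a
  have hm : 0 ≤ ∫ z, X z ∂μ := integral_nonneg fun _ => norm_nonneg _
  -- Exceeding `mean + 1` per channel use is a deviation of more than `n`, whereas the variance is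
  -- only linear in `n`. The constant does not depend on `ε`, which permits a fixed spacing of the
  -- codewords.
  refine ⟨∫ z, X z ∂μ + 1, by linarith, fun ε hε => ?_⟩
  obtain ⟨n₀, hn₀⟩ := exists_nat_gt (Var[X; μ] / ε)
  refine ⟨n₀ + 1, fun n hn => ?_⟩
  have hn0 : (0 : ℝ) < n := by exact_mod_cast (by omega : 0 < n)
  set S : (Fin n → Fin a → ℂ) → ℝ := ∑ s, fun z => X (z s) with hS
  have hcoord : ∀ s : Fin n, MemLp (fun z : Fin n → Fin a → ℂ => X (z s)) 2
      (Measure.pi fun _ => μ) := fun s =>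
    hX.comp_measurePreserving (measurePreserving_eval (fun _ : Fin n => μ) s)
  have hS2 : MemLp S 2 (Measure.pi fun _ => μ) := memLp_finsetSum' _ fun s _ => hcoord s
  have hint : ∫ z, S z ∂(Measure.pi fun _ => μ) = n * ∫ z, X z ∂μ := by
    simp only [hS, Finset.sum_apply]
    rw [integral_finsetSum _ fun s _ => (hcoord s).integrable (by norm_num)]
    have : ∀ s : Fin n, ∫ z : Fin n → Fin a → ℂ, X (z s) ∂(Measure.pi fun _ => μ) =
        ∫ z, X z ∂μ := fun s =>
      integral_comp_eval (μ := fun _ : Fin n => μ) measurable_norm.aestronglyMeasurable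
    simp [this]
  have hvar : Var[S; Measure.pi fun _ => μ] = n * Var[X; μ] := by
    rw [hS, variance_sum_pi fun _ => hX]
    simp
  have hcheb := meas_ge_le_variance_div_sq hS2 hn0
  rw [hint, hvar] at hcheb
  refine (measure_mono fun z hz => ?_).trans (hcheb.trans (ENNReal.ofReal_le_ofReal ?_))
  · have hz' : (∫ z, X z ∂μ + 1) * n < S z := by
      simpa [hS, Finset.sum_apply] using hz
    change (n : ℝ) ≤ |S z - n * ∫ z, X z ∂μ|
    refine le_trans ?_ (le_abs_self _)
    linarith
  · have h1 : (n₀ : ℝ) ≤ n := by exact_mod_cast (by omega : n₀ ≤ n)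
    rw [div_le_iff₀ (by positivity)]
    have h2 : Var[X; μ] ≤ ε * n := by
      have := (div_lt_iff₀ hε).1 (hn₀.trans_le h1)
      linarith
    calc n * Var[X; μ] ≤ n * (ε * n) := by gcongr
      _ = ε * (n : ℝ) ^ 2 := by ring

/-! ### Packing -/

lemma sum_half_pow_dist_le (q x : ℕ) :
    ∑ k ∈ Finset.range q, (1 / 2 : ℝ) ^ ((k - x) + (x - k)) ≤ 4 := by
  have h1 : ∑ k ∈ Finset.range (x + 1), (1 / 2 : ℝ) ^ ((k - x) + (x - k)) ≤ 2 := by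
    rw [← Finset.sum_range_reflect]
    refine le_trans (le_of_eq ?_) (sum_geometric_two_le (x + 1))
    refine Finset.sum_congr rfl fun k hk => ?_
    rw [Finset.mem_range] at hk
    congr 1
    omega
  have h2 : ∑ k ∈ Finset.Ico x (x + q), (1 / 2 : ℝ) ^ ((k - x) + (x - k)) ≤ 2 := by
    rw [Finset.sum_Ico_eq_sum_range]
    refine le_trans (le_of_eq ?_) (sum_geometric_two_le q)
    rw [Nat.add_sub_cancel_left]
    refine Finset.sum_congr rfl fun k hk => ?_
    congr 1
    omega
  calc ∑ k ∈ Finset.range q, (1 / 2 : ℝ) ^ ((k - x) + (x - k))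
      ≤ ∑ k ∈ Finset.range (x + 1) ∪ Finset.Ico x (x + q),
          (1 / 2 : ℝ) ^ ((k - x) + (x - k)) := by
        refine Finset.sum_le_sum_of_subset_of_nonneg (fun k hk => ?_) fun _ _ _ => by positivity
        simp only [Finset.mem_range, Finset.mem_union, Finset.mem_Ico] at hk ⊢
        omega
    _ ≤ _ := by
        refine le_trans (le_of_le_of_eq (le_add_of_nonneg_right ?_) (Finset.sum_union_inter)) ?_
        · exact Finset.sum_nonneg fun _ _ => by positivity
        · linarith

/-- The `ℓ¹` distance of words with letters in `{0, …, q - 1}`. -/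
def wordDist {ι : Type*} [Fintype ι] {q : ℕ} (x y : ι → Fin q) : ℕ :=
  ∑ i, (((x i : ℕ) - y i) + ((y i : ℕ) - x i))

lemma wordDist_comm {ι : Type*} [Fintype ι] {q : ℕ} (x y : ι → Fin q) :
    wordDist x y = wordDist y x :=
  Finset.sum_congr rfl fun _ _ => add_comm _ _

lemma wordDist_self {ι : Type*} [Fintype ι] {q : ℕ} (x : ι → Fin q) : wordDist x x = 0 := by
  simp [wordDist]

lemma abs_cast_sub_cast (a b : ℕ) : |(a : ℝ) - b| = (((a - b) + (b - a) : ℕ) : ℝ) := by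
  rcases le_total a b with h | h
  · rw [Nat.sub_eq_zero_of_le h, zero_add, Nat.cast_sub h, abs_sub_comm,
      abs_of_nonneg (sub_nonneg.2 (by exact_mod_cast h))]
  · rw [Nat.sub_eq_zero_of_le h, add_zero, Nat.cast_sub h,
      abs_of_nonneg (sub_nonneg.2 (by exact_mod_cast h))]

/-- A Chernoff-type count: each word in the ball has weight at least 1 under `2 ^ (n - dist)`, and
the sum of the weights over all words factors over the letters. -/
lemma card_wordDist_le {ι : Type*} [Fintype ι] [DecidableEq ι] {q : ℕ} (x : ι → Fin q) (n : ℕ) :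
    (({y | wordDist y x ≤ n} : Finset (ι → Fin q)).card : ℝ) ≤ 2 ^ n * 4 ^ Fintype.card ι := by
  calc (({y | wordDist y x ≤ n} : Finset (ι → Fin q)).card : ℝ)
      = ∑ y ∈ ({y | wordDist y x ≤ n} : Finset (ι → Fin q)), 1 := by simp
    _ ≤ ∑ y ∈ ({y | wordDist y x ≤ n} : Finset (ι → Fin q)),
          2 ^ n * (1 / 2 : ℝ) ^ wordDist y x := by
        refine Finset.sum_le_sum fun y hy => ?_
        have hy' := (Finset.mem_filter.1 hy).2
        rw [one_div, inv_pow, ← div_eq_mul_inv, one_le_div (by positivity)]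
        exact pow_le_pow_right₀ (by norm_num) hy'
    _ ≤ ∑ y : ι → Fin q, 2 ^ n * (1 / 2 : ℝ) ^ wordDist y x :=
        Finset.sum_le_sum_of_subset_of_nonneg (Finset.subset_univ _) fun _ _ _ => by positivity
    _ = 2 ^ n * ∏ i, ∑ k : Fin q, (1 / 2 : ℝ) ^ (((k : ℕ) - x i) + ((x i : ℕ) - k)) := by
        rw [← Finset.mul_sum, Finset.prod_univ_sum, Fintype.piFinset_univ]
        simp only [wordDist, Finset.prod_pow_eq_pow_sum]
    _ ≤ 2 ^ n * 4 ^ Fintype.card ι := by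
        gcongr
        refine (Finset.prod_le_prod (fun i _ => Finset.sum_nonneg fun _ _ => by positivity)
          (g := fun _ => 4) fun i _ => ?_).trans_eq (by simp)
        rw [Fin.sum_univ_eq_sum_range (fun k => (1 / 2 : ℝ) ^ ((k - (x i : ℕ)) + ((x i : ℕ) - k))) q]
        exact sum_half_pow_dist_le q (x i)

/-- A Gilbert–Varshamov bound for the `ℓ¹` distance. -/
lemma exists_packing (ι : Type*) [Fintype ι] [DecidableEq ι] (q n : ℕ) :
    ∃ (W : ℕ) (code : Fin W → ι → Fin q),
      (∀ w w', w ≠ w' → n < wordDist (code w) (code w')) ∧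
      (q : ℝ) ^ Fintype.card ι ≤ W * (2 ^ n * 4 ^ Fintype.card ι) := by
  classical
  let good : Finset (Finset (ι → Fin q)) :=
    {C | ∀ x ∈ C, ∀ y ∈ C, x ≠ y → n < wordDist x y}
  -- In a code of maximal size the balls of radius `n` cover all words, as an uncovered word could
  -- be added.
  obtain ⟨C, hC, hmax⟩ := good.exists_max_image Finset.card ⟨∅, by simp [good]⟩
  have hCg : ∀ x ∈ C, ∀ y ∈ C, x ≠ y → n < wordDist x y := (Finset.mem_filter.1 hC).2
  have hcover : ∀ y, ∃ x ∈ C, wordDist y x ≤ n := by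
    intro y
    by_contra! hy
    have hyC : y ∉ C := fun h => by simpa [wordDist_self] using hy y h
    have hins : insert y C ∈ good := by
      refine Finset.mem_filter.2 ⟨Finset.mem_univ _, fun x hx z hz hxz => ?_⟩
      rcases Finset.mem_insert.1 hx with hx | hx <;> rcases Finset.mem_insert.1 hz with hz | hz
      · exact absurd (hx.trans hz.symm) hxz
      · exact hx ▸ hy z hz
      · rw [hz, wordDist_comm]; exact hy x hx
      · exact hCg x hx z hz hxz
    have := hmax _ hins
    rw [Finset.card_insert_of_notMem hyC] at this
    omega
  refine ⟨C.card, fun w => (C.equivFin.symm w : ι → Fin q), fun w w' hne => ?_, ?_⟩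
  · exact hCg _ (C.equivFin.symm w).2 _ (C.equivFin.symm w').2
      fun h => hne (C.equivFin.symm.injective (Subtype.ext h))
  · have hsub : (Finset.univ : Finset (ι → Fin q)) ⊆
        C.biUnion fun x => ({y | wordDist y x ≤ n} : Finset (ι → Fin q)) := by
      intro y _
      obtain ⟨x, hx, hxy⟩ := hcover y
      exact Finset.mem_biUnion.2 ⟨x, hx, Finset.mem_filter.2 ⟨Finset.mem_univ _, hxy⟩⟩
    calc (q : ℝ) ^ Fintype.card ι = ((Finset.univ : Finset (ι → Fin q)).card : ℝ) := by simp
      _ ≤ ((C.biUnion fun x => ({y | wordDist y x ≤ n} : Finset (ι → Fin q))).card : ℝ) := by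
          exact_mod_cast Finset.card_le_card hsub
      _ ≤ ∑ x ∈ C, (({y | wordDist y x ≤ n} : Finset (ι → Fin q)).card : ℝ) := by
          exact_mod_cast Finset.card_biUnion_le
      _ ≤ ∑ x ∈ C, (2 ^ n * 4 ^ Fintype.card ι : ℝ) :=
          Finset.sum_le_sum fun x _ => card_wordDist_le x n
      _ = C.card * (2 ^ n * 4 ^ Fintype.card ι) := by simp

/-! ### Zero forcing at the receivers -/

/-- Zero forcing: a real-linear map recovers the desired streams at receiver `r` and removes
all interference. -/
lemma IsScheme.exists_zeroForcing (hS : IsScheme H b P) (r : Fin 2) :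
    ∃ T : (Fin (N r) → ℂ) →ₗ[ℝ] ((t : Fin 2) × Stream b r t → ℝ),
      (∀ q, T (Matrix.of (H r q.1) *ᵥ P r q.1 q.2.1 q.2.2) = Pi.single q 1) ∧
      ∀ t i k, T (Matrix.of (H r t) *ᵥ P (1 - r) t i k) = 0 := by
  classical
  have hli := hS.indep_rx r
  set dir : ((t : Fin 2) × Stream b r t) ⊕ Fin (b (1 - r) 1 2) → (Fin (N r) → ℂ) :=
    Sum.elim _ _ with hdir
  obtain ⟨G, hG⟩ := LinearMap.exists_leftInverse_of_injective
    (Finsupp.linearCombination ℝ dir) (LinearMap.ker_eq_bot.2 hli)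
  have hGdir : ∀ j, G (dir j) = Finsupp.single j 1 := fun j => by
    have := LinearMap.congr_fun hG (Finsupp.single j 1)
    simpa using this
  let T : (Fin (N r) → ℂ) →ₗ[ℝ] ((t : Fin 2) × Stream b r t → ℝ) :=
    LinearMap.pi fun q => Finsupp.lapply (Sum.inl q) ∘ₗ G
  have hTdir : ∀ j q, T (dir j) q = Finsupp.single j (1 : ℝ) (Sum.inl q) := fun j q => by
    simp only [T, LinearMap.pi_apply, LinearMap.comp_apply, hGdir, Finsupp.lapply_apply]
  have hT1 : ∀ k, T (Matrix.of (H r 1) *ᵥ P (1 - r) 1 2 k) = 0 := fun k => by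
    ext q
    have := hTdir (Sum.inr k) q
    simpa [hdir] using this
  have hrr : 1 - (1 - r) = r := by simp
  have hnull := hS.null_v (1 - r)
  have halign := hS.aligned (1 - r)
  rw [hrr] at hnull halign
  refine ⟨T, fun q => ?_, fun t i k => ?_⟩
  · ext q'
    have := hTdir (Sum.inl q) q'
    rw [Finsupp.single_apply] at this
    simp only [Sum.inl.injEq] at this
    rw [Pi.single_apply]
    simpa [hdir, eq_comm] using this
  · fin_cases i
    · exact (congrArg T (hnull t k)).trans (map_zero T)
    · have h := hS.rot_w (1 - r) t k
      change T (Matrix.of (H r t) *ᵥ P (1 - r) t 1 k) = 0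
      rw [h, Matrix.mulVec_smul, hnull, smul_zero, map_zero]
    · revert t
      rw [Fin.forall_fin_two]
      refine ⟨fun k => ?_, hT1⟩
      -- The third block of transmitter 0 arrives on the real lines of that of transmitter 1, which
      -- the filter already removes.
      have hmem : Matrix.of (H r 0) *ᵥ P (1 - r) 0 2 k ∈ Submodule.span ℝ
          {Matrix.of (H r 1) *ᵥ P (1 - r) 1 2 (Fin.castLE (hS.le_u (1 - r)) k)} := by
        rw [halign k]
        exact Submodule.mem_span_singleton_self _
      obtain ⟨s, hs⟩ := Submodule.mem_span_singleton.1 hmem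
      change T (Matrix.of (H r 0) *ᵥ P (1 - r) 0 2 k) = 0
      rw [← hs, map_smul, hT1, smul_zero]

lemma sum_fin_two_self_add_one_sub {A : Type*} [AddCommMonoid A] (f : Fin 2 → A) (r : Fin 2) :
    ∑ r', f r' = f r + f (1 - r) := by
  fin_cases r
  · exact Fin.sum_univ_two f
  · exact (Fin.sum_univ_two f).trans (add_comm _ _)

lemma zeroForcing_received {r : Fin 2} {T : (Fin (N r) → ℂ) →ₗ[ℝ] ((t : Fin 2) × Stream b r t → ℝ)}
    (hT : ∀ q, T (Matrix.of (H r q.1) *ᵥ P r q.1 q.2.1 q.2.2) = Pi.single q 1)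
    (hT' : ∀ t i k, T (Matrix.of (H r t) *ᵥ P (1 - r) t i k) = 0)
    (g : (r t : Fin 2) → Stream b r t → ℝ) (z : Fin (N r) → ℂ) (t : Fin 2) (q : Stream b r t) :
    T ((∑ t, Matrix.of (H r t) *ᵥ ∑ r', ∑ q : Stream b r' t, g r' t q • P r' t q.1 q.2) + z) ⟨t, q⟩ =
      g r t q + T z ⟨t, q⟩ := by
  have h1 : ∀ t, T (Matrix.of (H r t) *ᵥ ∑ r', ∑ q : Stream b r' t, g r' t q • P r' t q.1 q.2) =
      ∑ q : Stream b r t, g r t q • Pi.single ⟨t, q⟩ 1 := by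
    intro t
    rw [sum_fin_two_self_add_one_sub _ r, Matrix.mulVec_add, Matrix.mulVec_sum, Matrix.mulVec_sum,
      map_add, map_sum, map_sum]
    simp only [Matrix.mulVec_smul, map_smul, hT', smul_zero, Finset.sum_const_zero, add_zero]
    exact Finset.sum_congr rfl fun q _ => by rw [← hT ⟨t, q⟩]
  rw [map_add, map_sum, Pi.add_apply, Finset.sum_apply]
  congr 1
  rw [Finset.sum_congr rfl fun t _ => by rw [h1 t], Finset.sum_eq_single t]
  · rw [Finset.sum_apply, Finset.sum_eq_single q]
    · simp
    · intro q' _ hq'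
      have : (⟨t, q⟩ : (t : Fin 2) × Stream b r t) ≠ ⟨t, q'⟩ := fun h => hq' (by
        simpa using h.symm)
      simp [this]
    · simp
  · intro t' _ ht'
    rw [Finset.sum_apply]
    refine Finset.sum_eq_zero fun q' _ => ?_
    have : (⟨t, q⟩ : (t : Fin 2) × Stream b r t) ≠ ⟨t', q'⟩ := fun h => ht' (by
      cases h; rfl)
    simp [this]
  · simp

lemma exists_filtered_noise_bound {r : Fin 2}
    (T : (Fin (N r) → ℂ) →ₗ[ℝ] ((t : Fin 2) × Stream b r t → ℝ)) :
    ∃ B : ℝ, 0 ≤ B ∧ ∀ ε : ℝ, 0 < ε → ∃ n₀ : ℕ, ∀ n ≥ n₀, noiseLaw n (N r)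
      {z | ∃ t, B * n < ∑ s, ∑ q : Stream b r t, |T (z s) ⟨t, q⟩|} ≤ ENNReal.ofReal ε := by
  obtain ⟨c, hc, h⟩ := exists_noise_bound (N r)
  set K : ℝ := ‖LinearMap.toContinuousLinearMap T‖
  have hK : ∀ z q, |T z q| ≤ K * ‖z‖ := fun z q =>
    (norm_le_pi_norm (T z) q).trans ((LinearMap.toContinuousLinearMap T).le_opNorm z)
  have hK0 : 0 ≤ K := norm_nonneg _
  set L : ℝ := ∑ t, (Fintype.card (Stream b r t) : ℝ)
  have hL : ∀ t, (Fintype.card (Stream b r t) : ℝ) ≤ L := fun t =>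
    Finset.single_le_sum (f := fun t => (Fintype.card (Stream b r t) : ℝ))
      (fun _ _ => Nat.cast_nonneg _) (Finset.mem_univ t)
  have hL0 : 0 ≤ L := (Nat.cast_nonneg _).trans (hL 0)
  refine ⟨L * K * c, by positivity, fun ε hε => ?_⟩
  obtain ⟨n₀, hn₀⟩ := h ε hε
  refine ⟨n₀, fun n hn => (measure_mono ?_).trans (hn₀ n hn)⟩
  rintro z ⟨t, hz⟩
  by_contra hcon
  have hcon' : ∑ s, ‖z s‖ ≤ c * n := not_lt.1 hcon
  refine absurd hz (not_lt.2 ?_)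
  calc ∑ s, ∑ q : Stream b r t, |T (z s) ⟨t, q⟩| ≤ ∑ s, ∑ q : Stream b r t, K * ‖z s‖ :=
        Finset.sum_le_sum fun s _ => Finset.sum_le_sum fun q _ => hK _ _
    _ = Fintype.card (Stream b r t) * K * ∑ s, ‖z s‖ := by
        rw [Finset.mul_sum]
        refine Finset.sum_congr rfl fun s _ => ?_
        rw [Finset.sum_const, Finset.card_univ, nsmul_eq_mul, mul_assoc]
    _ ≤ L * K * (c * n) := by
        have := hL t
        gcongr
    _ = L * K * c * n := by ring

/-! ### Codes -/

/-- A measurable decoder for finitely many measurable decision regions. -/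
lemma exists_measurable_decoder {Y : Type*} [MeasurableSpace Y] {W : ℕ} (hW : 0 < W)
    (D : Fin W → Set Y) (hD : ∀ w, MeasurableSet (D w)) :
    ∃ dec : Y → Fin W, Measurable dec ∧
      ∀ y w, y ∈ D w → (∀ w', y ∈ D w' → w' = w) → dec y = w := by
  classical
  let φ : Y → Fin W → Prop := fun y w => y ∈ D w
  have hφ : Measurable φ := measurable_pi_iff.2 fun w => measurable_mem.2 (hD w)
  -- The decoder sees only which decision regions contain `y`. This pattern takes finitely many
  -- values, so any choice rule on it is measurable; the default is irrelevant.
  let g : (Fin W → Prop) → Fin W := fun s => if h : ∃ w, s w then h.choose else ⟨0, hW⟩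
  refine ⟨g ∘ φ, (measurable_of_finite g).comp hφ, fun y w hy hu => ?_⟩
  have h : ∃ w, φ y w := ⟨w, hy⟩
  simp only [Function.comp, g, dif_pos h]
  exact hu _ h.choose_spec

lemma card_stream (b : BlockLengths) (r t : Fin 2) :
    Fintype.card (Stream b r t) = msgLength b r t := by
  simp [Stream, msgLength]

/-- The codes: for each message, words with letters in `{0, …, q}` of large `ℓ¹` distance, sent
with a fixed spacing that is large compared with the filtered noise. -/
theorem IsScheme.exists_codes (hS : IsScheme H b P) :
    ∃ κ : ℝ, 0 < κ ∧ ∀ q : ℕ, ∀ ε : ℝ, 0 < ε → ∃ n₀ : ℕ, ∀ n ≥ n₀, ∃ c : XCode M N n,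
      c.IsPrecoded P ∧ (∀ ρ : ℝ, (q * κ) ^ 2 ≤ ρ → c.PowerLE ρ) ∧ c.ErrorLE H ε ∧
      ∀ r t, ((q + 1 : ℕ) : ℝ) ^ (n * msgLength b r t) ≤
        c.W r t * (2 ^ n * 4 ^ (n * msgLength b r t)) := by
  classical
  choose T hT hT' using hS.exists_zeroForcing
  choose B hB0 hB using fun r => exists_filtered_noise_bound (T r)
  -- Distinct codewords are more than `Δ * n` apart in `ℓ¹`, while filtered noise typically stays
  -- below `Δ / 2 * n`; the added 1 keeps `Δ` positive.
  set Δ : ℝ := 2 * ∑ r, B r + 1 with hΔ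
  have hBsum : ∀ r, B r ≤ ∑ r, B r := fun r =>
    Finset.single_le_sum (fun r _ => hB0 r) (Finset.mem_univ r)
  have hΔ0 : 0 < Δ := by
    have := (hB0 0).trans (hBsum 0)
    positivity
  set S : Fin 2 → ℝ := fun t => ∑ r, ∑ q : Stream b r t, ‖P r t q.1 q.2‖ with hSdef
  have hS0 : ∀ t, 0 ≤ S t := fun t =>
    Finset.sum_nonneg fun _ _ => Finset.sum_nonneg fun _ _ => norm_nonneg _
  -- Each antenna of transmitter `t` has amplitude at most `q * (Δ * S t)`. The factor `M t` absorbs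
  -- the sum over antennas, and the 1 makes the constant positive.
  refine ⟨1 + ∑ t, M t * (Δ * S t), ?_, fun q ε hε => ?_⟩
  · have : 0 ≤ ∑ t, M t * (Δ * S t) := Finset.sum_nonneg fun t _ => by
      have := hS0 t
      positivity
    linarith
  choose n₀ hn₀ using fun r => hB r ε hε
  refine ⟨∑ r, n₀ r, fun n hn => ?_⟩
  choose W code hdist hcard using fun r t =>
    exists_packing (Fin n × Stream b r t) (q + 1) n
  have hcardι : ∀ r t, Fintype.card (Fin n × Stream b r t) = n * msgLength b r t := fun r t => by
    rw [Fintype.card_prod, card_stream, Fintype.card_fin]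
  have hW : ∀ r t, 0 < W r t := fun r t => by
    by_contra h
    have h0 : W r t = 0 := by omega
    have := hcard r t
    rw [h0, Nat.cast_zero, zero_mul] at this
    exact absurd this (not_le.2 (by positivity))
  let f : (r t : Fin 2) → Fin (W r t) → Fin n → Stream b r t → ℝ :=
    fun r t w s i => Δ * (code r t w (s, i) : ℕ)
  let D : (r t : Fin 2) → Fin (W r t) → Set (Fin n → Fin (N r) → ℂ) := fun r t w =>
    {y | ∑ s, ∑ i : Stream b r t, |T r (y s) ⟨t, i⟩ - f r t w s i| ≤ Δ / 2 * n}
  have hD : ∀ r t w, MeasurableSet (D r t w) := fun r t w => by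
    have hTc : Continuous (T r) := (T r).continuous_of_finiteDimensional
    refine measurableSet_le (Continuous.measurable ?_) measurable_const
    fun_prop
  choose dec hdecm hdec using fun r t => exists_measurable_decoder (hW r t) (D r t) (hD r t)
  let c : XCode M N n :=
    { W := W
      enc := fun t m s => ∑ r, ∑ i : Stream b r t, f r t (m r) s i • P r t i.1 i.2
      dec := fun r y t => dec r t y
      measurable_dec := fun r => measurable_pi_iff.2 fun t => hdecm r t }
  have hunique : ∀ r t w w' y, y ∈ D r t w → y ∈ D r t w' → w' = w := by
    intro r t w w' y hy hy'
    by_contra hne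
    have h1 : (n : ℝ) < wordDist (code r t w') (code r t w) := by
      exact_mod_cast hdist r t w' w hne
    have h2 : Δ * wordDist (code r t w') (code r t w) =
        ∑ s, ∑ i : Stream b r t, |f r t w' s i - f r t w s i| := by
      rw [wordDist, Fintype.sum_prod_type]
      push_cast
      rw [Finset.mul_sum]
      refine Finset.sum_congr rfl fun s _ => ?_
      rw [Finset.mul_sum]
      refine Finset.sum_congr rfl fun i _ => ?_
      simp only [f]
      rw [← mul_sub, abs_mul, abs_of_pos hΔ0, abs_cast_sub_cast]
      push_cast
      rfl
    have h3 : ∑ s, ∑ i : Stream b r t, |f r t w' s i - f r t w s i| ≤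
        ∑ s, ∑ i : Stream b r t, |T r (y s) ⟨t, i⟩ - f r t w' s i| +
        ∑ s, ∑ i : Stream b r t, |T r (y s) ⟨t, i⟩ - f r t w s i| := by
      rw [← Finset.sum_add_distrib]
      refine Finset.sum_le_sum fun s _ => ?_
      rw [← Finset.sum_add_distrib]
      refine Finset.sum_le_sum fun i _ => ?_
      rw [abs_sub_comm (T r (y s) ⟨t, i⟩) (f r t w' s i)]
      exact abs_sub_le _ _ _
    have h4 : Δ * wordDist (code r t w') (code r t w) ≤ Δ * n := by
      rw [h2]
      refine h3.trans ((add_le_add hy' hy).trans_eq (by ring))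
    exact absurd (le_of_mul_le_mul_left h4 hΔ0) (not_le.2 h1)
  refine ⟨c, ⟨f, fun _ _ _ => rfl⟩, fun ρ hρ t m => ?_, fun m r => ?_, fun r t => ?_⟩
  · have henc : ∀ s, ‖c.enc t m s‖ ≤ q * (Δ * S t) := fun s => by
      calc ‖c.enc t m s‖ ≤ ∑ r, ∑ i : Stream b r t, ‖f r t (m r) s i • P r t i.1 i.2‖ := by
            change ‖∑ r, ∑ i : Stream b r t, f r t (m r) s i • P r t i.1 i.2‖ ≤ _
            refine (norm_sum_le _ _).trans (Finset.sum_le_sum fun r _ => ?_)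
            exact norm_sum_le _ _
        _ ≤ ∑ r, ∑ i : Stream b r t, q * Δ * ‖P r t i.1 i.2‖ := by
            refine Finset.sum_le_sum fun r _ => Finset.sum_le_sum fun i _ => ?_
            rw [norm_smul]
            gcongr
            have h1 : ((code r t (m r) (s, i) : ℕ) : ℝ) ≤ q := by
              exact_mod_cast Nat.lt_succ_iff.1 (code r t (m r) (s, i)).2
            simp only [f]
            rw [Real.norm_of_nonneg (by positivity), mul_comm]
            gcongr
        _ = q * (Δ * S t) := by
            simp only [hSdef, Finset.mul_sum, mul_assoc]
    have hsq : ∀ s, ∑ a, ‖c.enc t m s a‖ ^ 2 ≤ ρ := fun s => by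
      have hMM : (M t : ℝ) ≤ (M t : ℝ) ^ 2 := by exact_mod_cast Nat.le_self_pow two_ne_zero _
      have hle : M t * (Δ * S t) ≤ 1 + ∑ t, M t * (Δ * S t) := by
        have := Finset.single_le_sum (f := fun t => M t * (Δ * S t))
          (fun t _ => by have := hS0 t; positivity) (Finset.mem_univ t)
        linarith
      have hSt := hS0 t
      calc ∑ a, ‖c.enc t m s a‖ ^ 2 ≤ ∑ a : Fin (M t), (q * (Δ * S t)) ^ 2 := by
            refine Finset.sum_le_sum fun a _ => ?_
            gcongr
            exact (norm_le_pi_norm (c.enc t m s) a).trans (henc s)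
        _ = M t * (q * (Δ * S t)) ^ 2 := by simp
        _ ≤ (M t : ℝ) ^ 2 * (q * (Δ * S t)) ^ 2 := by gcongr
        _ = (q * (M t * (Δ * S t))) ^ 2 := by ring
        _ ≤ (q * (1 + ∑ t, M t * (Δ * S t))) ^ 2 := by gcongr
        _ ≤ ρ := hρ
    refine (Finset.sum_le_sum fun s _ => hsq s).trans_eq ?_
    simp
  · have hnr : n₀ r ≤ n :=
      (Finset.single_le_sum (fun r _ => Nat.zero_le (n₀ r)) (Finset.mem_univ r)).trans hn
    refine (measure_mono fun z hz => ?_).trans (hn₀ r n hnr)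
    by_contra hcon
    refine hz ?_
    simp only [Set.mem_ofPred_eq, not_exists, not_lt] at hcon
    funext t
    have hmem : c.received H m r z ∈ D r t (m r t) := by
      have hrec : ∀ s i, T r (c.received H m r z s) ⟨t, i⟩ - f r t (m r t) s i =
          T r (z s) ⟨t, i⟩ := fun s i => by
        have := zeroForcing_received (hT r) (hT' r) (fun r t i => f r t (m r t) s i) (z s) t i
        rw [sub_eq_iff_eq_add', ← this]
        rfl
      have hle : ∑ s, ∑ i : Stream b r t,
          |T r (c.received H m r z s) ⟨t, i⟩ - f r t (m r t) s i| ≤ B r * n := by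
        simp only [hrec]
        exact hcon t
      refine hle.trans ?_
      have : B r ≤ Δ / 2 := by
        have := hBsum r
        linarith
      gcongr
    exact hdec r t _ _ hmem fun w' hw' => hunique r t _ _ _ hmem hw'
  · have := hcard r t
    rwa [hcardι] at this

/-! ### From codes to degrees of freedom -/

lemma tendsto_logb_floor_div_logb {κ : ℝ} (hκ : 0 < κ) :
    Tendsto (fun ρ : ℝ => Real.logb 2 ((⌊√ρ / κ⌋₊ + 1 : ℕ) : ℝ) / Real.logb 2 ρ) atTop
      (𝓝 (1 / 2)) := by
  have hlog : Tendsto (fun ρ : ℝ => Real.logb 2 ρ) atTop atTop :=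
    Real.tendsto_logb_atTop (by norm_num)
  have haux : ∀ c : ℝ, Tendsto (fun ρ : ℝ => 1 / 2 + c / Real.logb 2 ρ) atTop (𝓝 (1 / 2)) :=
    fun c => by simpa using tendsto_const_nhds.add (hlog.const_div_atTop c)
  refine tendsto_of_tendsto_of_tendsto_of_le_of_le' (haux (-Real.logb 2 κ))
    (haux (Real.logb 2 (1 / κ + 1))) ?_ ?_
  all_goals
    filter_upwards [eventually_gt_atTop 1] with ρ hρ
    have hL : 0 < Real.logb 2 ρ := Real.logb_pos (by norm_num) hρ
    have hs : 1 ≤ √ρ := Real.one_le_sqrt.2 hρ.le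
    have hsl : Real.logb 2 √ρ = Real.logb 2 ρ / 2 := by
      rw [Real.logb, Real.logb, Real.log_sqrt (by linarith)]
      ring
  · have h1 : √ρ / κ ≤ ((⌊√ρ / κ⌋₊ + 1 : ℕ) : ℝ) := by
      push_cast
      exact (Nat.lt_floor_add_one _).le
    have h2 := Real.logb_le_logb_of_le (b := 2) (by norm_num) (by positivity) h1
    rw [Real.logb_div (by positivity) hκ.ne', hsl] at h2
    rw [le_div_iff₀ hL, add_mul, div_mul_cancel₀ _ hL.ne']
    linarith
  · have h1 : ((⌊√ρ / κ⌋₊ + 1 : ℕ) : ℝ) ≤ √ρ * (1 / κ + 1) := by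
      push_cast
      have := Nat.floor_le (show 0 ≤ √ρ / κ by positivity)
      rw [mul_add, mul_one_div]
      linarith
    have h2 := Real.logb_le_logb_of_le (b := 2) (by norm_num) (by positivity) h1
    rw [Real.logb_mul (by positivity) (by positivity), hsl] at h2
    rw [div_le_iff₀ hL, add_mul, div_mul_cancel₀ _ hL.ne']
    linarith

/-- Every scheme achieves half a degree of freedom per real message symbol. -/
theorem IsScheme.achievesDoF (hS : IsScheme H b P) :
    AchievesDoF H P fun r t => (msgLength b r t : ℝ) / 2 := by
  obtain ⟨κ, hκ, hcodes⟩ := hS.exists_codes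
  let l : ℝ → ℝ := fun ρ => Real.logb 2 ((⌊√ρ / κ⌋₊ + 1 : ℕ) : ℝ)
  -- The packing loses a factor 4 per symbol and 2 per channel use, hence the `-2` and `-1`. At low
  -- power the formula may be negative, and rate 0 needs only one message.
  refine ⟨fun ρ r t => max 0 (msgLength b r t * (l ρ - 2) - 1), fun ρ hρ =>
    ⟨fun r t => le_max_left _ _, fun ε hε => ?_⟩, fun r t => ?_⟩
  · obtain ⟨n₀, hn₀⟩ := hcodes ⌊√ρ / κ⌋₊ ε hε
    refine ⟨n₀, fun n hn => ?_⟩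
    obtain ⟨c, hc1, hc2, hc3, hc4⟩ := hn₀ n hn
    refine ⟨c, hc1, hc2 ρ ?_, hc3, fun r t => ?_⟩
    · have h1 : ⌊√ρ / κ⌋₊ * κ ≤ √ρ := (le_div_iff₀ hκ).1 (Nat.floor_le (by positivity))
      calc (⌊√ρ / κ⌋₊ * κ) ^ 2 ≤ √ρ ^ 2 := by gcongr
        _ = ρ := Real.sq_sqrt hρ.le
    · have h := hc4 r t
      set q : ℝ := ((⌊√ρ / κ⌋₊ + 1 : ℕ) : ℝ) with hq
      have hq0 : 0 < q := by positivity
      rcases le_total (msgLength b r t * (l ρ - 2) - 1) 0 with h0 | h0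
      · beta_reduce
        rw [max_eq_left h0, mul_zero, Real.rpow_zero]
        have hpos : (0 : ℝ) < c.W r t := by
          by_contra hcon
          have : (c.W r t : ℝ) = 0 := le_antisymm (not_lt.1 hcon) (Nat.cast_nonneg _)
          rw [this, zero_mul] at h
          exact absurd h (not_le.2 (by positivity))
        exact_mod_cast hpos
      · beta_reduce
        rw [max_eq_right h0]
        have hexp : (2 : ℝ) ^ ((n : ℝ) * (msgLength b r t * (l ρ - 2) - 1)) =
            q ^ (n * msgLength b r t) / (2 ^ n * 4 ^ (n * msgLength b r t)) := by
          have h4 : (4 : ℝ) = 2 ^ (2 : ℝ) := by norm_num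
          have hql : q = 2 ^ l ρ := (Real.rpow_logb (by norm_num) (by norm_num) hq0).symm
          rw [h4, hql]
          rw [← Real.rpow_natCast, ← Real.rpow_natCast, ← Real.rpow_natCast,
            ← Real.rpow_mul (by norm_num), ← Real.rpow_mul (by norm_num),
            ← Real.rpow_add (by norm_num), ← Real.rpow_sub (by norm_num)]
          congr 1
          push_cast
          ring
        rw [hexp, div_le_iff₀ (by positivity)]
        exact h
  · have hlog : Tendsto (fun ρ : ℝ => Real.logb 2 ρ) atTop atTop :=
      Real.tendsto_logb_atTop (by norm_num)
    have h1 : Tendsto (fun ρ : ℝ => msgLength b r t * (l ρ / Real.logb 2 ρ) -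
        (2 * msgLength b r t + 1) / Real.logb 2 ρ) atTop (𝓝 (msgLength b r t * (1 / 2) - 0)) :=
      ((tendsto_logb_floor_div_logb hκ).const_mul _).sub (hlog.const_div_atTop _)
    have h2 := (tendsto_const_nhds (x := (0 : ℝ))).max h1
    have h3 : max 0 (msgLength b r t * (1 / 2) - 0 : ℝ) = msgLength b r t / 2 := by
      rw [max_eq_right (by simp)]
      ring
    rw [h3] at h2
    refine h2.congr' ?_
    filter_upwards [eventually_gt_atTop 1] with ρ hρ
    have hL : 0 < Real.logb 2 ρ := Real.logb_pos (by norm_num) hρ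
    rw [← max_div_div_right hL.le, zero_div]
    congr 1
    ring

end

end MIMOX

/-! ### The main theorem -/

theorem theorem3 (M N : Fin 2 → ℕ) (hN : 0 < N 1) (hM10 : M 1 ≤ M 0) (hMN : N 0 ≤ M 1)
    (hN10 : N 1 ≤ N 0) (hC : M 0 + M 1 ≤ 3 * N 1) (v : ℝ≥0) (hv : v ≠ 0)
    (x : ℤ) (hx : x = 3 * (N 1 : ℤ) - ((M 0 : ℤ) + M 1))
    (D : ℝ) (hD : D = (M 0 : ℝ) + M 1 - N 1 + 1 / 2 * (⌊(2 * x / 3 : ℚ)⌋ : ℝ)) :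
    -- the value of the formula, compared with the outer bound `2 (M₁ + M₂) / 3`
    (x % 3 = 0 → D = 2 * ((M 0 : ℝ) + M 1) / 3) ∧
    (x % 3 = 1 → D = 2 * ((M 0 : ℝ) + M 1) / 3 - 1 / 3) ∧
    (x % 3 = 2 → D = 2 * ((M 0 : ℝ) + M 1) / 3 - 1 / 6) ∧
    -- for almost every channel
    ∀ᵐ H ∂(MIMOX.channelLaw M N v),
      -- the scheme achieves `D`, with the stated message lengths
      (∃ (b : MIMOX.BlockLengths) (P : MIMOX.Precoders M b),
        MIMOX.IsScheme H b P ∧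
        MIMOX.AchievesDoF H P (fun r t => (MIMOX.msgLength b r t : ℝ) / 2) ∧
        ∑ r, ∑ t, (MIMOX.msgLength b r t : ℝ) / 2 = D ∧
        (MIMOX.msgLength b 0 0 : ℤ) = 2 * ((M 0 : ℤ) - N 1) + ⌊(2 * x / 3 : ℚ)⌋ ∧
        (MIMOX.msgLength b 1 0 : ℤ) = 2 * ((M 0 : ℤ) - N 1) + ⌊(2 * x / 3 : ℚ)⌋ ∧
        (MIMOX.msgLength b 0 1 : ℤ) = (M 1 : ℤ) + N 1 - M 0 - ⌈((x - 1) / 3 : ℚ)⌉ ∧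
        (MIMOX.msgLength b 1 1 : ℤ) = (M 1 : ℤ) + N 1 - M 0 - ⌊(x / 3 : ℚ)⌋ ∧
        (2 ≤ N 0 → ¬ (M 0 + M 1 = 3 * N 1 ∧ M 0 + M 1 = 2 * N 0 + N 1) →
          ∀ r t, 0 < MIMOX.msgLength b r t)) ∧
      -- and no choice of block lengths and precoders in the scheme gives more
      (∀ (b : MIMOX.BlockLengths) (P : MIMOX.Precoders M b), MIMOX.IsScheme H b P →
        ∑ r, ∑ t, (MIMOX.msgLength b r t : ℝ) / 2 ≤ D) := by
  have hxN : (3 * N 1 : ℤ) = x + (M 0 + M 1) := by omega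
  rw [MIMOX.floor_two_mul_div_three] at hD
  have hMN' : ∀ r t, N r ≤ M t := by
    simp only [Fin.forall_fin_two]
    omega
  have hxR : (3 * N 1 : ℝ) = x + (M 0 + M 1) := by exact_mod_cast hxN
  -- The correction `3 * ⌊2x/3⌋ - 2x` is minus the residue of `2x` modulo 3, which yields the three
  -- cases.
  have hDS : (3 * (2 * D) : ℝ) = 4 * ((M 0 : ℝ) + M 1) + (3 * (2 * x / 3 : ℤ) - 2 * x) := by
    rw [hD]
    linarith
  have hval : ∀ k : ℤ, 3 * (2 * x / 3) - 2 * x = k →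
      D = 2 * ((M 0 : ℝ) + M 1) / 3 + k / 6 := fun k hk => by
    have : (3 * (2 * x / 3 : ℤ) - 2 * x : ℝ) = k := by exact_mod_cast hk
    rw [this] at hDS
    linarith
  refine ⟨fun h => ?_, fun h => ?_, fun h => ?_, ?_⟩
  · rw [hval 0 (by omega)]; norm_num
  · rw [hval (-2) (by omega)]; push_cast; ring
  · rw [hval (-1) (by omega)]; push_cast; ring
  rw [MIMOX.floor_two_mul_div_three, MIMOX.floor_div_three, MIMOX.ceil_sub_one_div_three]
  obtain ⟨y, rfl⟩ : ∃ y : ℕ, x = y := ⟨x.toNat, by omega⟩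
  have hy : y + (M 0 + M 1) = 3 * N 1 := by omega
  have hsurj : ∀ᵐ H ∂MIMOX.channelLaw M N v, ∀ r t,
      Function.Surjective (Matrix.of (H r t)).mulVec :=
    ae_all_iff.2 fun r => ae_all_iff.2 fun t => MIMOX.ae_mulVec_surjective hv r t (hMN' r t)
  filter_upwards [MIMOX.ae_exists_isScheme M N hM10 hMN hN10 v hv y hy, hsurj]
    with H ⟨P, hP⟩ hH
  constructor
  · have h00 : MIMOX.msgLength (MIMOX.nullBlocks M N (MIMOX.alignedLengths N y)) 0 0 =
        2 * (M 0 - N 1) + 2 * y / 3 := by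
      simp [MIMOX.msgLength, Fin.sum_univ_three, MIMOX.nullBlocks, MIMOX.alignedLengths]
      omega
    have h10 : MIMOX.msgLength (MIMOX.nullBlocks M N (MIMOX.alignedLengths N y)) 1 0 =
        2 * (M 0 - N 1) + 2 * y / 3 := by
      simp [MIMOX.msgLength, Fin.sum_univ_three, MIMOX.nullBlocks, MIMOX.alignedLengths]
      omega
    have h01 : MIMOX.msgLength (MIMOX.nullBlocks M N (MIMOX.alignedLengths N y)) 0 1 =
        2 * (M 1 - N 1) + (y - (y + 1) / 3) := by
      simp [MIMOX.msgLength, Fin.sum_univ_three, MIMOX.nullBlocks, MIMOX.alignedLengths]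
      omega
    have h11 : MIMOX.msgLength (MIMOX.nullBlocks M N (MIMOX.alignedLengths N y)) 1 1 =
        2 * (M 1 - N 1) + (y - y / 3) := by
      simp [MIMOX.msgLength, Fin.sum_univ_three, MIMOX.nullBlocks, MIMOX.alignedLengths]
      omega
    refine ⟨_, P, hP, hP.achievesDoF, ?_, ?_, ?_, ?_, ?_, ?_⟩
    · have hsum : ∀ a b c d : ℕ, a = 2 * (M 0 - N 1) + 2 * y / 3 →
          b = 2 * (M 1 - N 1) + (y - (y + 1) / 3) → c = 2 * (M 0 - N 1) + 2 * y / 3 →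
          d = 2 * (M 1 - N 1) + (y - y / 3) →
          ((a + b + c + d : ℕ) : ℤ) = 2 * (M 0 + M 1 - N 1) + 2 * y / 3 := by
        intro a b c d ha hb hc hd
        have := hMN' 1 0
        have := hMN' 1 1
        have h1 : 2 * y / 3 = (y + 1) / 3 + y / 3 := by omega
        have h2 : (2 * (y : ℤ) / 3) = ((2 * y / 3 : ℕ) : ℤ) := by omega
        have h3 : (y + 1) / 3 ≤ y := by omega
        have h4 : y / 3 ≤ y := by omega
        rw [h2, ha, hb, hc, hd]
        generalize 2 * y / 3 = e1 at *
        generalize (y + 1) / 3 = e2 at *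
        generalize y / 3 = e3 at *
        omega
      have hR := congrArg (Int.cast : ℤ → ℝ) (hsum _ _ _ _ h00 h01 h10 h11)
      push_cast at hR
      simp only [Fin.sum_univ_two]
      rw [hD]
      linarith
    · rw [h00]; omega
    · rw [h10]; omega
    · rw [h01]; omega
    · rw [h11]; omega
    · intro hN2 hne
      simp only [Fin.forall_fin_two]
      rw [h00, h01, h10, h11]
      -- A zero length from transmitter 0 forces all antenna numbers to equal `y` with `y ≤ 1`,
      -- against `2 ≤ N 0`. A zero length from transmitter 1 forces `y = 0` and `M 1 = N 0 = N 1`,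
      -- which is excluded.
      omega
  · intro b P hP
    have h := hP.three_mul_sum_le hH hMN'
    -- Integrality of the total length turns the bound `4 * (M 0 + M 1) / 3` into its floor, which
    -- is `2 * D`.
    have hle : ((∑ r, ∑ t, MIMOX.msgLength b r t : ℕ) : ℤ) ≤
        2 * (M 0 + M 1 - N 1) + 2 * y / 3 := by omega
    have hR : ((∑ r, ∑ t, MIMOX.msgLength b r t : ℕ) : ℝ) ≤
        2 * (M 0 + M 1 - N 1) + ((2 * y / 3 : ℤ) : ℝ) := by exact_mod_cast hle
    push_cast at hR
    simp only [← Finset.sum_div]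
    rw [hD]
    linarith
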